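/- Let $X=\{X(s,t):(s,t)\in[0,1]^2\}$ and $\epsilon=\{\epsilon(s):s\in[0,1]\}$ be real, jointly measurable, mean-zero processes with finite second moments at every point, where $c((s,t),(s',t'))=\mathrm{cov}\{X(s,t),X(s',t')\}$ is continuous; let $\Gamma(s,s')=\mathrm{cov}\{\epsilon(s),\epsilon(s')\}$. Let $X_1,X_2,\dots$ be iid copies of $X$, let $\epsilon_{1,ij}$ ($i,j\ge1$) be iid copies of $\epsilon$, and let $T_{ij}$ ($i,j\ge 1$) be iid random variables in $[0,1]$ with density $g$; the families $(X_i)$, $(T_{ij})$, $(\epsilon_{1,ij})$ are mutually independent. Subject $i$ has $m_i\ge1$ visits, where the numbers $m_i$ are non-random and satisfy $\sum_{i\le n}m_i^2/(\sum_{i\le n}m_i)^2\to0$ as $n\to\infty$ (for instance, the $m_i$ are bounded). For $1\le j\le m_i$ one observes the curves $$Y_{ij}(s)=W_i(s,T_{ij})=X_i(s,T_{ij})+\epsilon_{1,ij}(s),\qquad s\in[0,1].$$ Put $\Sigma(s,s')=\int_0^1 c((s,t),(s',t))\,g(t)\,dt$, $\Xi=\Sigma+\Gamma$, and $$\widehat\Xi(s,s')=\widehat\Xi_n(s,s')=\frac{\sum_{i=1}^n\sum_{j=1}^{m_i}Y_{ij}(s)Y_{ij}(s')}{\sum_{i=1}^n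 m_i}.$$ Assume $\mathrm E\iint X^2(s,t)\,ds\,dt<\infty$, that $g$ is continuous and bounded, and $\mathrm E\int\epsilon^2(s)\,ds<\infty$. (a) If $X(s,t)X(s',t)X(s,t')X(s',t')$ is integrable for all $s,s',t,t'$, then for each $(s,s')$, $|\widehat\Xi(s,s')-\Xi(s,s')|\to0$ in probability as $n\to\infty$. (b) If $\mathrm E\|X(\cdot,t)\|_{L^2[0,1]}^4<\infty$ for each $t$ and $\mathrm E\|\epsilon\|_{L^2[0,1]}^4<\infty$, then $\{\iint(\widehat\Xi-\Xi)^2(s,s')\,ds\,ds'\}^{1/2}\to0$ in probability as $n\to\infty$. (c) Under the assumptions of (b), let $(\lambda_k,\phi_k)_{k\ge1}$, with $\lambda_1\ge\lambda_2\ge\dots\ge0$ and $(\phi_k)$ orthonormal in $L^2[0,1]$, be the eigenvalues and eigenfunctions of the integral operator with kernel $\Xi$, all positive eigenvalues being listed with their multiplicities; let $(\widehat\lambda_k,\widehat\phi_k)_{k\ge1}$ be (almost surely, for each $n$) the same for $\widehat\Xi$. Let $k$ be such that $\lambda_k$ is a simple eigenvalue ($\lambda_l\neq\lambda_k$ for $l\neq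 k$), and let the sign of $\widehat\phi_k$ be chosen such that $\int\widehat\phi_k\phi_k\ge0$. Let $\xi_{W,ijk}=\int W_i(s,T_{ij})\phi_k(s)\,ds$ be the scores and $\widetilde\xi_{W,ijk}=\int Y_{ij}(s)\widehat\phi_k(s)\,ds$ the proxy scores. Then for each $i$, $$\sup_{1\le j\le m_i}|\widetilde\xi_{W,ijk}-\xi_{W,ijk}|\to0\quad\text{in probability as } n\to\infty.$$ -/

import Mathlib

open MeasureTheory ProbabilityTheory Filter Topology
open scoped ENNReal

noncomputable section

/-- The model for response curves observed with smooth error,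
`Y_ij(s) = X_i(s, T_ij) + ε_ij(s)` for `s ∈ [0,1]`, with mean zero.

`X` and `e` are the generic (jointly measurable) processes, defined on probability spaces
`(𝓧, PX)` and `(𝓔, PE)`. The `i`-th subject's process is the copy `X (x i ω)`, and the `j`-th error
curve of subject `i` is the copy `e (ε i j ω)`; `T i j` are the visit times, with density `g`
on `[0,1]`, and `m i` is the number of visits of subject `i`. -/
structure LongitudinalModel {Ω 𝓧 𝓔 : Type*}
    [MeasurableSpace Ω] [MeasurableSpace 𝓧] [MeasurableSpace 𝓔]
    (μ : Measure Ω) (PX : Measure 𝓧) (PE : Measure 𝓔)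
    (X : 𝓧 → unitInterval → unitInterval → ℝ) (e : 𝓔 → unitInterval → ℝ)
    (g : unitInterval → ℝ) (m : ℕ → ℕ)
    (x : ℕ → Ω → 𝓧) (T : ℕ → ℕ → Ω → unitInterval) (ε : ℕ → ℕ → Ω → 𝓔) : Prop where
  /-- The process `X(s,t)` is jointly measurable, has second moments, and mean zero. -/
  measurable_X : Measurable fun p : 𝓧 × unitInterval × unitInterval => X p.1 p.2.1 p.2.2
  memLp_X : ∀ s t, MemLp (fun u => X u s t) 2 PX
  mean_X : ∀ s t, ∫ u, X u s t ∂PX = 0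
  /-- The covariance function of `X` is continuous. -/
  continuous_cov : Continuous fun p : (unitInterval × unitInterval) × unitInterval × unitInterval =>
    cov[fun u => X u p.1.1 p.1.2, fun u => X u p.2.1 p.2.2; PX]
  /-- The error process `e(s)` is jointly measurable, has second moments, and mean zero. -/
  measurable_e : Measurable fun p : 𝓔 × unitInterval => e p.1 p.2
  memLp_e : ∀ s, MemLp (fun v => e v s) 2 PE
  mean_e : ∀ s, ∫ v, e v s ∂PE = 0
  /-- `X_i` are iid copies of `X`. -/
  measurable_x : ∀ i, Measurable (x i)
  map_x : ∀ i, μ.map (x i) = PX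
  indep_x : iIndepFun x μ
  /-- `ε_ij` are iid copies of `e`. -/
  measurable_ε : ∀ i j, Measurable (ε i j)
  map_ε : ∀ i j, μ.map (ε i j) = PE
  indep_ε : iIndepFun (fun p : ℕ × ℕ => ε p.1 p.2) μ
  /-- The visit times are iid with density `g`. -/
  g_nonneg : ∀ t, 0 ≤ g t
  measurable_T : ∀ i j, Measurable (T i j)
  map_T : ∀ i j, μ.map (T i j) = (volume : Measure unitInterval).withDensity
    fun t => ENNReal.ofReal (g t)
  indep_T : iIndepFun (fun p : ℕ × ℕ => T p.1 p.2) μ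
  /-- The processes `X_i`, the visit times, and the errors are independent of each other. -/
  indep_x_Tε : IndepFun (fun ω (i : ℕ) => x i ω)
    (fun ω (p : ℕ × ℕ) => (T p.1 p.2 ω, ε p.1 p.2 ω)) μ
  indep_T_ε : IndepFun (fun ω (p : ℕ × ℕ) => T p.1 p.2 ω) (fun ω (p : ℕ × ℕ) => ε p.1 p.2 ω) μ
  /-- Sparse longitudinal design: every subject is seen, and no subject dominates the pooled
  sample, `∑ m_i² / (∑ m_i)² → 0` (in particular if the `m_i` are bounded). -/
  one_le_m : ∀ i, 1 ≤ m i
  sparse : Tendsto (fun n : ℕ =>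
    (∑ i ∈ Finset.range n, (m i : ℝ) ^ 2) / (∑ i ∈ Finset.range n, (m i : ℝ)) ^ 2) atTop (𝓝 0)

/-- The observed curve `Y_ij(s) = W_i(s, T_ij) = X_i(s, T_ij) + ε_ij(s)`. -/
def observedCurve {Ω 𝓧 𝓔 : Type*}
    (X : 𝓧 → unitInterval → unitInterval → ℝ) (e : 𝓔 → unitInterval → ℝ)
    (x : ℕ → Ω → 𝓧) (T : ℕ → ℕ → Ω → unitInterval) (ε : ℕ → ℕ → Ω → 𝓔)
    (i j : ℕ) (ω : Ω) (s : unitInterval) : ℝ :=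
  X (x i ω) s (T i j ω) + e (ε i j ω) s

/-- The pooled sample covariance
`(∑_{i<n} ∑_{j<m_i} Y_ij(s) Y_ij(s')) / ∑_{i<n} m_i` of the curves `Y`. -/
def pooledCov {Ω : Type*} (Y : ℕ → ℕ → Ω → unitInterval → ℝ) (m : ℕ → ℕ)
    (n : ℕ) (ω : Ω) (s s' : unitInterval) : ℝ :=
  (∑ i ∈ Finset.range n, ∑ j ∈ Finset.range (m i), Y i j ω s * Y i j ω s') /
    ∑ i ∈ Finset.range n, (m i : ℝ)

/-- The marginal covariance `Σ(s,s') = ∫ c((s,t),(s',t)) g(t) dt`, with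
`c((s,t),(s',t')) = cov(X(s,t), X(s',t'))`. -/
def marginalCov {𝓧 : Type*} [MeasurableSpace 𝓧] (PX : Measure 𝓧)
    (X : 𝓧 → unitInterval → unitInterval → ℝ) (g : unitInterval → ℝ) (s s' : unitInterval) : ℝ :=
  ∫ t, cov[fun u => X u s t, fun u => X u s' t; PX] * g t

/-- The error covariance `Γ(s,s') = cov(e(s), e(s'))`. -/
def errorCov {𝓔 : Type*} [MeasurableSpace 𝓔] (PE : Measure 𝓔)
    (e : 𝓔 → unitInterval → ℝ) (s s' : unitInterval) : ℝ :=
  cov[fun v => e v s, fun v => e v s'; PE]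

/-- `Ξ = Σ + Γ`. -/
def totalCov {𝓧 𝓔 : Type*} [MeasurableSpace 𝓧] [MeasurableSpace 𝓔]
    (PX : Measure 𝓧) (PE : Measure 𝓔)
    (X : 𝓧 → unitInterval → unitInterval → ℝ) (e : 𝓔 → unitInterval → ℝ)
    (g : unitInterval → ℝ) (s s' : unitInterval) : ℝ :=
  marginalCov PX X g s s' + errorCov PE e s s'

/-- The Hilbert–Schmidt norm `(∬ k²(s,s') ds ds')^{1/2}` of a kernel, with value `∞` when the
kernel is not square integrable. -/
def hsNorm (k : unitInterval → unitInterval → ℝ) : ℝ≥0∞ :=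
  (∫⁻ s, ∫⁻ s', ‖k s s'‖ₑ ^ 2) ^ (1 / 2 : ℝ)

/-- `(φ_k, lam_k)` is the spectral decomposition of the integral operator with kernel `K` on
`L²[0,1]`: the `φ_k` are orthonormal eigenfunctions with eigenvalues `lam_0 ≥ lam_1 ≥ … ≥ 0`, and
the operator vanishes on the orthogonal complement of the `φ_k` (which is `0` when the `φ_k` form
a basis), so that all positive eigenvalues are listed, with their multiplicities. -/
structure IsSpectralDecomposition (K : unitInterval → unitInterval → ℝ)
    (φ : ℕ → Lp ℝ 2 (volume : Measure unitInterval)) (lam : ℕ → ℝ) : Prop where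
  orthonormal : Orthonormal ℝ φ
  antitone : Antitone lam
  nonneg : ∀ k, 0 ≤ lam k
  eigen : ∀ k, ∀ᵐ s : unitInterval, ∫ s', K s s' * φ k s' = lam k * φ k s
  complete : ∀ f : Lp ℝ 2 (volume : Measure unitInterval), (∀ k, inner ℝ (φ k) f = 0) →
    ∀ᵐ s : unitInterval, ∫ s', K s s' * f s' = 0

/-- The score `∫ y(s) φ(s) ds` of a curve `y` in the direction `φ`. -/
def score (y : unitInterval → ℝ) (φ : Lp ℝ 2 (volume : Measure unitInterval)) : ℝ :=
  ∫ s, y s * φ s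

end

/-!
The kernel `Y(s) Y(s')` of the curve observed at a visit is an integrable random element of the
Hilbert space of kernels on `L²[0,1]`, whose mean is the total covariance: the process and error
parts are uncorrelated, and the visit time integrates out to the marginal covariance. All visits
have the same law, and visits of different subjects are independent, so both pointwise and
Hilbert–Schmidt consistency are instances of a law of large numbers for cluster means in a Hilbert
space. For square integrable summands the centred terms of different clusters are orthogonal, so
the second moment of the mean is at most `∑ mᵢ² / (∑ mᵢ)²` times that of a single term; as a cluster
mean contracts `L¹` norms, approximation in `L¹` by simple functions reduces the integrable case to
this one.

For the scores, the gap around the simple eigenvalue `lam k` together with Weyl's inequality gives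
`‖φhat k - φ k‖ ≤ C ‖Ξhat - Ξ‖`, and the scores of the finitely many curves of a fixed subject
change by at most `‖φhat k - φ k‖` times their `L²` norms, which do not depend on `n`.
-/

noncomputable section

theorem isProbabilityMeasure_of_measurePreserving {α β : Type*} [MeasurableSpace α]
    [MeasurableSpace β] {μ : Measure α} {ν : Measure β} [IsProbabilityMeasure μ] {f : α → β}
    (hf : MeasurePreserving f μ ν) : IsProbabilityMeasure ν :=
  hf.map_eq ▸ Measure.isProbabilityMeasure_map hf.aemeasurable

/-! ### The law of large numbers for cluster means -/

section ClusterMean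

variable {H : Type*} [NormedAddCommGroup H] [InnerProductSpace ℝ H] {m : ℕ → ℕ}

/-- The average of an array `v` of vectors over its first `n` clusters, where cluster `i` consists
of the `v i j` with `j < m i`. -/
def clusterMean (m : ℕ → ℕ) (n : ℕ) (v : ℕ → ℕ → H) : H :=
  (∑ i ∈ Finset.range n, (m i : ℝ))⁻¹ • ∑ i ∈ Finset.range n, ∑ j ∈ Finset.range (m i), v i j

theorem clusterMean_sub (n : ℕ) (v w : ℕ → ℕ → H) :
    clusterMean m n (fun i j => v i j - w i j) = clusterMean m n v - clusterMean m n w := by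
  simp only [clusterMean, Finset.sum_sub_distrib, smul_sub]

theorem clusterMean_const (hm : ∀ i, 1 ≤ m i) {n : ℕ} (hn : n ≠ 0) (c : H) :
    clusterMean m n (fun _ _ => c) = c := by
  have hpos : 0 < ∑ i ∈ Finset.range n, (m i : ℝ) :=
    Finset.sum_pos (fun i _ => by exact_mod_cast hm i) (Finset.nonempty_range_iff.2 hn)
  simp only [clusterMean, Finset.sum_const, Finset.card_range, ← Nat.cast_smul_eq_nsmul ℝ,
    ← Finset.sum_smul, inv_smul_smul₀ hpos.ne']

theorem norm_clusterMean_sq (n : ℕ) (v : ℕ → ℕ → H) :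
    ‖clusterMean m n v‖ ^ 2 = (∑ i ∈ Finset.range n, ∑ j ∈ Finset.range (m i),
      ∑ i' ∈ Finset.range n, ∑ j' ∈ Finset.range (m i'), inner ℝ (v i j) (v i' j')) /
        (∑ i ∈ Finset.range n, (m i : ℝ)) ^ 2 := by
  rw [clusterMean, norm_smul, mul_pow, norm_inv, inv_pow, Real.norm_eq_abs, sq_abs, inv_mul_eq_div,
    ← real_inner_self_eq_norm_sq]
  simp only [sum_inner]
  simp only [inner_sum]

variable {Ω : Type*} [MeasurableSpace Ω] {μ : Measure Ω}

theorem aestronglyMeasurable_clusterMean {W : ℕ → ℕ → Ω → H}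
    (hW : ∀ i j, AEStronglyMeasurable (W i j) μ) (n : ℕ) :
    AEStronglyMeasurable (fun ω => clusterMean m n fun i j => W i j ω) μ := by
  unfold clusterMean
  fun_prop

theorem memLp_clusterMean {p : ℝ≥0∞} {W : ℕ → ℕ → Ω → H}
    (hW : ∀ i j, MemLp (W i j) p μ) (n : ℕ) :
    MemLp (fun ω => clusterMean m n fun i j => W i j ω) p μ :=
  (memLp_finsetSum _ fun i _ => memLp_finsetSum _ fun j _ => hW i j).const_smul _

theorem eLpNorm_clusterMean_le {p : ℝ≥0∞} (hp : 1 ≤ p) {W : ℕ → ℕ → Ω → H}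
    (hW : ∀ i j, AEStronglyMeasurable (W i j) μ) {C : ℝ≥0∞} (hC : ∀ i j, eLpNorm (W i j) p μ ≤ C)
    (n : ℕ) : eLpNorm (fun ω => clusterMean m n fun i j => W i j ω) p μ ≤ C := by
  set N : ℝ := ∑ i ∈ Finset.range n, (m i : ℝ)
  have hsum : eLpNorm (∑ i ∈ Finset.range n, ∑ j ∈ Finset.range (m i), W i j) p μ ≤ ‖N‖ₑ * C :=
    calc
      _ ≤ ∑ i ∈ Finset.range n, ∑ j ∈ Finset.range (m i), eLpNorm (W i j) p μ :=
        (eLpNorm_sum_le (fun i _ => Finset.aestronglyMeasurable_sum _ fun j _ => hW i j) hp).trans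
          (Finset.sum_le_sum fun i _ => eLpNorm_sum_le (fun j _ => hW i j) hp)
      _ ≤ ∑ i ∈ Finset.range n, ∑ _j ∈ Finset.range (m i), C :=
        Finset.sum_le_sum fun i _ => Finset.sum_le_sum fun j _ => hC i j
      _ = ‖N‖ₑ * C := by
        have hN : ‖N‖ₑ = ∑ i ∈ Finset.range n, (m i : ℝ≥0∞) := by
          simp only [N, ← Nat.cast_sum, Real.enorm_natCast]
        simp only [hN, Finset.sum_const, Finset.card_range, nsmul_eq_mul, Finset.sum_mul]
  have heq : (fun ω => clusterMean m n fun i j => W i j ω) =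
      N⁻¹ • ∑ i ∈ Finset.range n, ∑ j ∈ Finset.range (m i), W i j := by
    ext ω
    simp only [clusterMean, N, Pi.smul_apply, Finset.sum_apply]
  rw [heq, eLpNorm_const_smul]
  calc
    _ ≤ ‖N⁻¹‖ₑ * (‖N‖ₑ * C) := by gcongr
    _ = ‖N⁻¹ * N‖ₑ * C := by rw [enorm_mul, mul_assoc]
    _ ≤ 1 * C := by
      gcongr
      by_cases hN : N = 0 <;> simp [hN]
    _ = C := one_mul C

theorem integral_norm_clusterMean_sq_le {W : ℕ → ℕ → Ω → H} (hW : ∀ i j, MemLp (W i j) 2 μ)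
    (horth : ∀ i i' j j', i ≠ i' → ∫ ω, inner ℝ (W i j ω) (W i' j' ω) ∂μ = 0) {V : ℝ}
    (hV : ∀ i j, ∫ ω, ‖W i j ω‖ ^ 2 ∂μ ≤ V) (n : ℕ) :
    ∫ ω, ‖clusterMean m n fun i j => W i j ω‖ ^ 2 ∂μ ≤
      (∑ i ∈ Finset.range n, (m i : ℝ) ^ 2) / (∑ i ∈ Finset.range n, (m i : ℝ)) ^ 2 * V := by
  have hint : ∀ i j i' j', Integrable (fun ω => inner ℝ (W i j ω) (W i' j' ω)) μ :=
    fun i j i' j' =>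
      memLp_one_iff_integrable.1 ((innerSL ℝ).memLp_of_bilin 1 (hW i j) (hW i' j'))
  have hsq : ∀ i j, Integrable (fun ω => ‖W i j ω‖ ^ 2) μ :=
    fun i j => (hW i j).integrable_norm_pow two_ne_zero
  have hle : ∀ i i' j j',
      ∫ ω, inner ℝ (W i j ω) (W i' j' ω) ∂μ ≤ if i = i' then V else 0 := by
    intro i i' j j'
    split_ifs with hi
    · calc
        _ ≤ ∫ ω, (‖W i j ω‖ ^ 2 + ‖W i' j' ω‖ ^ 2) / 2 ∂μ :=
          integral_mono (hint i j i' j') (((hsq i j).add (hsq i' j')).div_const 2) fun ω => by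
            dsimp only
            nlinarith [real_inner_le_norm (W i j ω) (W i' j' ω),
              sq_nonneg (‖W i j ω‖ - ‖W i' j' ω‖)]
        _ ≤ V := by
          rw [integral_div, integral_add (hsq i j) (hsq i' j')]
          linarith [hV i j, hV i' j']
    · exact (horth i i' j j' hi).le
  simp only [norm_clusterMean_sq, integral_div, div_mul_eq_mul_div]
  gcongr
  calc
    _ = ∑ i ∈ Finset.range n, ∑ j ∈ Finset.range (m i), ∑ i' ∈ Finset.range n,
        ∑ j' ∈ Finset.range (m i'), ∫ ω, inner ℝ (W i j ω) (W i' j' ω) ∂μ := by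
      simp (disch := fun_prop) only [integral_finsetSum]
    _ ≤ ∑ i ∈ Finset.range n, ∑ _j ∈ Finset.range (m i), ∑ i' ∈ Finset.range n,
        ∑ _j' ∈ Finset.range (m i'), if i = i' then V else 0 := by
      gcongr
      exact hle _ _ _ _
    _ = (∑ i ∈ Finset.range n, (m i : ℝ) ^ 2) * V := by
      simp only [Finset.sum_const, Finset.card_range, smul_ite, smul_zero, Finset.sum_ite_eq,
        Finset.sum_mul, nsmul_eq_mul]
      exact Finset.sum_congr rfl fun i hi => by rw [if_pos hi]; ring

variable {E : Type*} [MeasurableSpace E] {Q : Measure E}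

theorem integral_inner_comp_eq_zero_of_indepFun [CompleteSpace H] {Z Z' : Ω → E}
    (hZ : MeasurePreserving Z μ Q) (hZ' : MeasurePreserving Z' μ Q) (hind : IndepFun Z Z' μ)
    {F : E → H} (hF : Integrable F Q) (hF0 : ∫ z, F z ∂Q = 0) :
    ∫ ω, inner ℝ (F (Z ω)) (F (Z' ω)) ∂μ = 0 := by
  have h := hind.integral_bilin_comp_comp hZ.aemeasurable hZ'.aemeasurable
    (hZ.map_eq.symm ▸ hF) (hZ'.map_eq.symm ▸ hF) (innerSL ℝ)
  rw [← integral_map hZ.aemeasurable (hZ.map_eq.symm ▸ hF.1), hZ.map_eq, hF0, map_zero] at h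
  exact h

theorem exists_memLp_two_integral_eq_zero_eLpNorm_sub_le [CompleteSpace H]
    [IsProbabilityMeasure Q] {F : E → H}
    (hF : Integrable F Q) (hF0 : ∫ z, F z ∂Q = 0) {δ : ℝ≥0∞} (hδ : δ ≠ 0) :
    ∃ G : E → H, MemLp G 2 Q ∧ ∫ z, G z ∂Q = 0 ∧ eLpNorm (F - G) 1 Q ≤ δ := by
  obtain ⟨G, hFG, -⟩ := (memLp_one_iff_integrable.2 hF).exists_simpleFunc_eLpNorm_sub_lt
    ENNReal.one_ne_top (ENNReal.half_pos hδ).ne'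
  have hG : Integrable G Q := G.integrable_of_isFiniteMeasure
  have hc : ‖∫ z, G z ∂Q‖ₑ ≤ δ / 2 := calc
    _ = ‖∫ z, (F - ⇑G) z ∂Q‖ₑ := by rw [integral_sub' hF hG, hF0, zero_sub, enorm_neg]
    _ ≤ eLpNorm (F - ⇑G) 1 Q := by
      rw [eLpNorm_one_eq_lintegral_enorm]
      exact enorm_integral_le_lintegral_enorm _
    _ ≤ δ / 2 := hFG.le
  refine ⟨fun z => G z - ∫ z, G z ∂Q,
    (G.memLp_of_isFiniteMeasure 2 Q).sub (memLp_const _), ?_, ?_⟩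
  · rw [integral_sub hG (integrable_const _), integral_const, probReal_univ, one_smul, sub_self]
  · calc
      _ = eLpNorm ((F - ⇑G) + fun _ => ∫ z, G z ∂Q) 1 Q := by
        congr 1
        ext z
        simp only [Pi.sub_apply, Pi.add_apply, sub_sub_eq_add_sub, sub_add_eq_add_sub]
      _ ≤ eLpNorm (F - ⇑G) 1 Q + eLpNorm (fun _ => ∫ z, G z ∂Q) 1 Q :=
        eLpNorm_add_le (hF.1.sub hG.1) aestronglyMeasurable_const le_rfl
      _ ≤ δ / 2 + δ / 2 := by
        gcongr
        rwa [eLpNorm_const _ one_ne_zero (NeZero.ne Q), measure_univ, ENNReal.one_rpow, mul_one]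
      _ = δ := ENNReal.add_halves δ

variable [IsProbabilityMeasure μ] [CompleteSpace H] {Z : ℕ → ℕ → Ω → E}
  (hsparse : Tendsto (fun n : ℕ =>
    (∑ i ∈ Finset.range n, (m i : ℝ) ^ 2) / (∑ i ∈ Finset.range n, (m i : ℝ)) ^ 2) atTop (𝓝 0))
  (hZ : ∀ i j, MeasurePreserving (Z i j) μ Q)
  (hind : ∀ i i' j j', i ≠ i' → IndepFun (Z i j) (Z i' j') μ)

include hsparse hZ hind

theorem tendsto_eLpNorm_clusterMean_of_memLp_two
    {F : E → H} (hF : MemLp F 2 Q) (hF0 : ∫ z, F z ∂Q = 0) :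
    Tendsto (fun n => eLpNorm (fun ω => clusterMean m n fun i j => F (Z i j ω)) 1 μ)
      atTop (𝓝 0) := by
  have := isProbabilityMeasure_of_measurePreserving (hZ 0 0)
  have hW : ∀ i j, MemLp (fun ω => F (Z i j ω)) 2 μ :=
    fun i j => hF.comp_measurePreserving (hZ i j)
  have hsq : ∀ n, ∫ ω, ‖clusterMean m n fun i j => F (Z i j ω)‖ ^ 2 ∂μ ≤
      (∑ i ∈ Finset.range n, (m i : ℝ) ^ 2) / (∑ i ∈ Finset.range n, (m i : ℝ)) ^ 2 *
        ∫ z, ‖F z‖ ^ 2 ∂Q :=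
    integral_norm_clusterMean_sq_le hW
      (fun i i' j j' hi => integral_inner_comp_eq_zero_of_indepFun (hZ i j) (hZ i' j')
        (hind i i' j j' hi) (hF.integrable one_le_two) hF0)
      fun i j => by
        rw [← (hZ i j).map_eq, integral_map (hZ i j).aemeasurable]
        exact (hZ i j).map_eq.symm ▸ hF.1.norm.pow 2
  have hlim : Tendsto (fun n : ℕ => ENNReal.ofReal (((∑ i ∈ Finset.range n, (m i : ℝ) ^ 2) /
      (∑ i ∈ Finset.range n, (m i : ℝ)) ^ 2 * ∫ z, ‖F z‖ ^ 2 ∂Q) ^ (1 / 2 : ℝ)))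
      atTop (𝓝 0) := by
    have h := (hsparse.mul_const (∫ z, ‖F z‖ ^ 2 ∂Q)).rpow_const (p := 1 / 2) (.inr (by norm_num))
    simpa using ENNReal.tendsto_ofReal h
  refine tendsto_of_tendsto_of_tendsto_of_le_of_le tendsto_const_nhds hlim
    (fun _ => zero_le) fun n => ?_
  calc
    _ ≤ eLpNorm (fun ω => clusterMean m n fun i j => F (Z i j ω)) 2 μ :=
      eLpNorm_le_eLpNorm_of_exponent_le one_le_two (memLp_clusterMean hW n).1
    _ = ENNReal.ofReal
        ((∫ ω, ‖clusterMean m n fun i j => F (Z i j ω)‖ ^ 2 ∂μ) ^ (1 / 2 : ℝ)) := by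
      simp [(memLp_clusterMean hW n).eLpNorm_eq_integral_rpow_norm two_ne_zero ENNReal.ofNat_ne_top]
    _ ≤ _ := by
      gcongr
      exact hsq n

theorem tendsto_eLpNorm_clusterMean
    {F : E → H} (hF : Integrable F Q) (hF0 : ∫ z, F z ∂Q = 0) :
    Tendsto (fun n => eLpNorm (fun ω => clusterMean m n fun i j => F (Z i j ω)) 1 μ)
      atTop (𝓝 0) := by
  have := isProbabilityMeasure_of_measurePreserving (hZ 0 0)
  refine ENNReal.tendsto_nhds_zero.2 fun δ hδ => ?_
  obtain ⟨G, hG, hG0, hFG⟩ :=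
    exists_memLp_two_integral_eq_zero_eLpNorm_sub_le hF hF0 (ENNReal.half_pos hδ.ne').ne'
  have hGZ := tendsto_eLpNorm_clusterMean_of_memLp_two hsparse hZ hind hG hG0
  filter_upwards [ENNReal.tendsto_nhds_zero.1 hGZ (δ / 2) (ENNReal.half_pos hδ.ne')] with n hn
  have hmeas : ∀ i j, AEStronglyMeasurable (fun ω => (F - G) (Z i j ω)) μ :=
    fun i j => (hF.1.sub hG.1).comp_measurePreserving (hZ i j)
  calc
    _ = eLpNorm ((fun ω => clusterMean m n fun i j => (F - G) (Z i j ω)) +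
        fun ω => clusterMean m n fun i j => G (Z i j ω)) 1 μ := by
      congr 1
      ext ω
      simp only [Pi.add_apply, Pi.sub_apply, clusterMean_sub, sub_add_cancel]
    _ ≤ δ / 2 + δ / 2 := (eLpNorm_add_le (aestronglyMeasurable_clusterMean hmeas n)
        (aestronglyMeasurable_clusterMean
          (fun i j => hG.1.comp_measurePreserving (hZ i j)) n) le_rfl).trans
        (add_le_add (eLpNorm_clusterMean_le le_rfl hmeas (fun i j =>
          (eLpNorm_comp_measurePreserving (hF.1.sub hG.1) (hZ i j)).trans_le hFG) n) hn)
    _ = δ := ENNReal.add_halves δ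

theorem tendstoInMeasure_clusterMean (hm : ∀ i, 1 ≤ m i)
    {F : E → H} (hF : Integrable F Q) :
    TendstoInMeasure μ (fun n ω => clusterMean m n fun i j => F (Z i j ω)) atTop
      (fun _ => ∫ z, F z ∂Q) := by
  have := isProbabilityMeasure_of_measurePreserving (hZ 0 0)
  set c := ∫ z, F z ∂Q with hc
  have hcent : Tendsto (fun n => eLpNorm (fun ω => clusterMean m n fun i j => F (Z i j ω) - c) 1 μ)
      atTop (𝓝 0) :=
    tendsto_eLpNorm_clusterMean hsparse hZ hind (F := fun z => F z - c)
      (hF.sub (integrable_const c)) (by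
        rw [integral_sub hF (integrable_const c), integral_const, probReal_univ, one_smul, hc,
          sub_self])
  refine tendstoInMeasure_of_tendsto_eLpNorm one_ne_zero
    (fun n => aestronglyMeasurable_clusterMean
      (fun i j => hF.1.comp_measurePreserving (hZ i j)) n)
    aestronglyMeasurable_const (hcent.congr' ?_)
  filter_upwards [eventually_ne_atTop 0] with n hn
  congr 1
  ext ω
  simp only [clusterMean_sub, clusterMean_const hm hn, Pi.sub_apply]

end ClusterMean

theorem eLpNorm_two_sq {α F : Type*} [MeasurableSpace α] [NormedAddCommGroup F] (f : α → F)
    (μ : Measure α) : eLpNorm f 2 μ ^ 2 = ∫⁻ x, ‖f x‖ₑ ^ 2 ∂μ := by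
  simpa using eLpNorm_nnreal_pow_eq_lintegral (f := f) (μ := μ) (p := 2) two_ne_zero

/-! ### Random square integrable curves -/

section WeakMeasurability

variable {E H : Type*} [MeasurableSpace E] [NormedAddCommGroup H] [InnerProductSpace ℝ H]

theorem stronglyMeasurable_starProjection {f : E → H}
    (hf : ∀ v, Measurable fun z => inner ℝ v (f z)) (V : Submodule ℝ H) [FiniteDimensional ℝ V] :
    StronglyMeasurable fun z => V.starProjection (f z) := by
  simp only [(stdOrthonormalBasis ℝ V).starProjection_eq_sum_rankOne, FunLike.coe_sum,
    Finset.sum_apply, InnerProductSpace.rankOne_apply]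
  exact Finset.stronglyMeasurable_fun_sum _ fun i _ => (hf _).stronglyMeasurable.smul_const _

theorem stronglyMeasurable_of_forall_measurable_inner [TopologicalSpace.SeparableSpace H]
    {f : E → H} (hf : ∀ v, Measurable fun z => inner ℝ v (f z)) : StronglyMeasurable f := by
  let d := TopologicalSpace.denseSeq H
  let V : ℕ → Submodule ℝ H := fun n => Submodule.span ℝ (d '' Set.Iic n)
  have hfin : ∀ n, FiniteDimensional ℝ (V n) := fun n =>
    FiniteDimensional.span_of_finite ℝ ((Set.finite_Iic n).image d)
  have hmono : Monotone V := fun n n' h =>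
    Submodule.span_mono (Set.image_mono (Set.Iic_subset_Iic.2 h))
  have hdense : ⊤ ≤ (⨆ n, V n).topologicalClosure := by
    intro x _
    refine closure_mono ?_ (TopologicalSpace.denseRange_denseSeq H x)
    rintro - ⟨n, rfl⟩
    exact Submodule.mem_iSup_of_mem n
      (Submodule.subset_span (Set.mem_image_of_mem d Set.self_mem_Iic))
  exact stronglyMeasurable_of_tendsto atTop (fun n => stronglyMeasurable_starProjection hf (V n))
    (tendsto_pi_nhds.2 fun z => Submodule.starProjection_tendsto_self V hmono (f z) hdense)

end WeakMeasurability

section sectionLp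

variable {E S : Type*} [MeasurableSpace S] {ν : Measure S} {y : E → S → ℝ}

open Classical in
/-- The curve `y z` as an element of `L²(ν)`, with the junk value `0` if it is not square
integrable. -/
def sectionLp (ν : Measure S) (y : E → S → ℝ) (z : E) : Lp ℝ 2 ν :=
  if h : MemLp (y z) 2 ν then h.toLp (y z) else 0

theorem coeFn_sectionLp {z : E} (h : MemLp (y z) 2 ν) : sectionLp ν y z =ᵐ[ν] y z := by
  rw [sectionLp, dif_pos h]
  exact h.coeFn_toLp

theorem inner_sectionLp {z : E} (h : MemLp (y z) 2 ν) (f : Lp ℝ 2 ν) :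
    inner ℝ f (sectionLp ν y z) = ∫ s, y z s * f s ∂ν := by
  rw [L2.inner_def]
  refine integral_congr_ae ?_
  filter_upwards [coeFn_sectionLp h] with s hs
  rw [hs, RCLike.inner_apply, conj_trivial]

variable [MeasurableSpace E] {Q : Measure E} [SFinite ν]

theorem measurableSet_memLp_two (hy : Measurable (Function.uncurry y)) :
    MeasurableSet {z | MemLp (y z) 2 ν} := by
  have heq : {z | MemLp (y z) 2 ν} = {z | ∫⁻ s, ‖y z s‖ₑ ^ 2 ∂ν < ∞} := by
    ext z
    have hz : AEStronglyMeasurable (y z) ν := (hy.of_uncurry_left).aestronglyMeasurable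
    simp [MemLp, hz, ← eLpNorm_two_sq, ENNReal.pow_lt_top_iff]
  rw [heq]
  exact measurableSet_lt (hy.enorm.pow_const 2).lintegral_prod_right' measurable_const

theorem stronglyMeasurable_sectionLp [IsSeparable ν] (hy : Measurable (Function.uncurry y)) :
    StronglyMeasurable (sectionLp ν y) := by
  have : Fact ((2 : ℝ≥0∞) ≠ ∞) := ⟨ENNReal.ofNat_ne_top⟩
  refine stronglyMeasurable_of_forall_measurable_inner fun f => ?_
  have heq : (fun z => inner ℝ f (sectionLp ν y z)) =
      {z | MemLp (y z) 2 ν}.indicator fun z => ∫ s, y z s * f s ∂ν := by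
    ext z
    by_cases h : MemLp (y z) 2 ν
    · rw [inner_sectionLp h, Set.indicator_of_mem (s := {z | MemLp (y z) 2 ν}) h]
    · rw [sectionLp, dif_neg h, inner_zero_right,
        Set.indicator_of_notMem (s := {z | MemLp (y z) 2 ν}) h]
  have hint : StronglyMeasurable fun z => ∫ s, y z s * f s ∂ν :=
    (hy.stronglyMeasurable.mul (g := fun p : E × S => f p.2)
      ((Lp.stronglyMeasurable f).comp_measurable measurable_snd)).integral_prod_right'
  exact heq ▸ hint.measurable.indicator (measurableSet_memLp_two hy)

theorem ae_memLp_two_of_memLp_uncurry (hy : MemLp (Function.uncurry y) 2 (Q.prod ν)) :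
    ∀ᵐ z ∂Q, MemLp (y z) 2 ν := by
  have hfin : ∫⁻ z, ∫⁻ s, ‖y z s‖ₑ ^ 2 ∂ν ∂Q ≠ ∞ := by
    have h := lintegral_prod _ (hy.1.enorm.pow_const 2)
    rw [← eLpNorm_two_sq] at h
    exact h ▸ ENNReal.pow_ne_top hy.2.ne
  filter_upwards [hy.1.prodMk_left, ae_lt_top' (hy.1.enorm.pow_const 2).lintegral_prod_right' hfin]
    with z hz hlt
  refine ⟨hz, ?_⟩
  rw [← eLpNorm_two_sq] at hlt
  simpa using hlt

theorem memLp_sectionLp [IsSeparable ν] (hy : Measurable (Function.uncurry y))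
    (hy2 : MemLp (Function.uncurry y) 2 (Q.prod ν)) : MemLp (sectionLp ν y) 2 Q := by
  refine ⟨(stronglyMeasurable_sectionLp hy).aestronglyMeasurable, ?_⟩
  have hsq : eLpNorm (sectionLp ν y) 2 Q ^ 2 = eLpNorm (Function.uncurry y) 2 (Q.prod ν) ^ 2 := by
    rw [eLpNorm_two_sq, eLpNorm_two_sq, lintegral_prod _ (hy2.1.enorm.pow_const 2)]
    refine lintegral_congr_ae ?_
    filter_upwards [ae_memLp_two_of_memLp_uncurry hy2] with z hz
    rw [sectionLp, dif_pos hz, Lp.enorm_toLp, eLpNorm_two_sq]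
    rfl
  rw [(ENNReal.pow_right_strictMono two_ne_zero).injective hsq]
  exact hy2.2

end sectionLp

section Bochner

variable {E S G : Type*} [MeasurableSpace E] [MeasurableSpace S] {Q : Measure E} {ν : Measure S}
  [NormedAddCommGroup G]

theorem lintegral_enorm_Lp_two_le (f : Lp G 2 ν) :
    ∫⁻ s, ‖f s‖ₑ ∂ν ≤ ‖f‖ₑ * ν Set.univ ^ (1 / 2 : ℝ) := by
  have h := eLpNorm_le_eLpNorm_mul_rpow_measure_univ one_le_two (Lp.aestronglyMeasurable f)
  rw [eLpNorm_one_eq_lintegral_enorm, ← Lp.enorm_def] at h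
  norm_num at h
  simpa using h

variable [IsFiniteMeasure ν] {K : E → Lp G 2 ν} {F : E → S → G}

theorem integrable_uncurry_of_ae_eq_Lp_two (hK : Integrable K Q)
    (hF : AEStronglyMeasurable (Function.uncurry F) (Q.prod ν)) (hKF : ∀ᵐ z ∂Q, K z =ᵐ[ν] F z) :
    Integrable (Function.uncurry F) (Q.prod ν) := by
  refine ⟨hF, ?_⟩
  rw [HasFiniteIntegral, lintegral_prod _ hF.enorm]
  calc
    _ = ∫⁻ z, ∫⁻ s, ‖K z s‖ₑ ∂ν ∂Q := lintegral_congr_ae <| by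
      filter_upwards [hKF] with z hz
      exact lintegral_congr_ae (hz.symm.fun_comp _)
    _ ≤ ∫⁻ z, ‖K z‖ₑ * ν Set.univ ^ (1 / 2 : ℝ) ∂Q := lintegral_mono fun z =>
      lintegral_enorm_Lp_two_le (K z)
    _ = (∫⁻ z, ‖K z‖ₑ ∂Q) * ν Set.univ ^ (1 / 2 : ℝ) := lintegral_mul_const'' _ hK.1.enorm
    _ < ∞ := ENNReal.mul_lt_top hK.2
      (ENNReal.rpow_lt_top_of_nonneg (by norm_num) (measure_ne_top ν _))

variable [InnerProductSpace ℝ G] [CompleteSpace G]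

theorem setIntegral_integral_Lp_two (hK : Integrable K Q)
    (hF : AEStronglyMeasurable (Function.uncurry F) (Q.prod ν)) (hKF : ∀ᵐ z ∂Q, K z =ᵐ[ν] F z)
    {A : Set S} (hA : MeasurableSet A) :
    ∫ s in A, (∫ z, K z ∂Q : Lp G 2 ν) s ∂ν = ∫ z, ∫ s in A, F z s ∂ν ∂Q := by
  have hint : Integrable (fun z => ∫ s in A, F z s ∂ν) Q :=
    ((integrable_uncurry_of_ae_eq_Lp_two hK hF hKF).mono_measure
      (Measure.prod_mono le_rfl Measure.restrict_le_self)).integral_prod_left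
  refine ext_inner_left ℝ fun c => ?_
  calc
    _ = inner ℝ (indicatorConstLp 2 hA (measure_ne_top ν A) c) (∫ z, K z ∂Q) :=
      (L2.inner_indicatorConstLp_eq_inner_setIntegral ℝ hA (measure_ne_top ν A) c _).symm
    _ = ∫ z, inner ℝ (indicatorConstLp 2 hA (measure_ne_top ν A) c) (K z) ∂Q :=
      (integral_inner hK _).symm
    _ = ∫ z, inner ℝ c (∫ s in A, F z s ∂ν) ∂Q := integral_congr_ae <| by
      filter_upwards [hKF] with z hz
      rw [L2.inner_indicatorConstLp_eq_inner_setIntegral ℝ hA,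
        integral_congr_ae (ae_restrict_of_ae hz)]
    _ = inner ℝ c (∫ z, ∫ s in A, F z s ∂ν ∂Q) := integral_inner hint c

theorem coeFn_integral_Lp_two [SFinite Q] (hK : Integrable K Q)
    (hF : AEStronglyMeasurable (Function.uncurry F) (Q.prod ν)) (hKF : ∀ᵐ z ∂Q, K z =ᵐ[ν] F z) :
    (∫ z, K z ∂Q : Lp G 2 ν) =ᵐ[ν] fun s => ∫ z, F z s ∂Q := by
  have hint := integrable_uncurry_of_ae_eq_Lp_two hK hF hKF
  refine Integrable.ae_eq_of_forall_setIntegral_eq _ _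
    ((Lp.memLp (∫ z, K z ∂Q)).integrable one_le_two) hint.integral_prod_right fun A hA _ => ?_
  exact (setIntegral_integral_Lp_two hK hF hKF hA).trans <| integral_integral_swap
    (hint.mono_measure (Measure.prod_mono le_rfl Measure.restrict_le_self))

end Bochner

/-! ### Hilbert–Schmidt kernels -/

section HilbertSchmidt

variable {E S : Type*} [MeasurableSpace S] {ν : Measure S}

variable (ν) in
/-- The space of Hilbert–Schmidt kernels on `L²(ν)`, a kernel `k` being encoded as the
square integrable function `s ↦ k(s, ·)` with values in `L²(ν)`. -/
abbrev HSKernel : Type _ := Lp (Lp ℝ 2 ν) 2 ν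

namespace HSKernel

/-- `K` is the class of the kernel function `k`. -/
def Represents (K : HSKernel ν) (k : S → S → ℝ) : Prop :=
  ∀ᵐ s ∂ν, K s =ᵐ[ν] k s

variable (ν) in
/-- The rank one kernel `(s, s') ↦ g(s) f(s')`, as a bilinear map. -/
def rankOne : Lp ℝ 2 ν →L[ℝ] Lp ℝ 2 ν →L[ℝ] HSKernel ν :=
  (ContinuousLinearMap.lsmul ℝ ℝ).flip.compLpL₂ 2 ν

variable (ν) in
/-- The operator on `L²(ν)` with kernel `K`, namely `f ↦ (s ↦ ∫ K(s, s') f(s') ds')`, as a linear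
function of the kernel. -/
def integralOp : HSKernel ν →L[ℝ] Lp ℝ 2 ν →L[ℝ] Lp ℝ 2 ν :=
  ((innerSL ℝ).compLpL₂ 2 ν).flip

theorem coeFn_rankOne (f g : Lp ℝ 2 ν) : rankOne ν f g =ᵐ[ν] fun s => g s • f :=
  ContinuousLinearMap.coeFn_compLp _ _

theorem coeFn_integralOp (K : HSKernel ν) (f : Lp ℝ 2 ν) :
    integralOp ν K f =ᵐ[ν] fun s => inner ℝ f (K s) :=
  ContinuousLinearMap.coeFn_compLp _ _

theorem norm_integralOp_le (K : HSKernel ν) : ‖integralOp ν K‖ ≤ ‖K‖ := by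
  refine ContinuousLinearMap.opNorm_le_bound _ (norm_nonneg K) fun f => ?_
  refine (ContinuousLinearMap.norm_compLp_le _ _).trans ?_
  rw [innerSL_apply_norm, mul_comm]

theorem represents_rankOne {f g : Lp ℝ 2 ν} {u v : S → ℝ} (hf : f =ᵐ[ν] u) (hg : g =ᵐ[ν] v) :
    Represents (rankOne ν f g) fun s s' => v s * u s' := by
  filter_upwards [coeFn_rankOne f g, hg] with s hs hgs
  rw [hs, hgs]
  filter_upwards [Lp.coeFn_smul (v s) f, hf] with s' hs' hfs'
  rw [hs', Pi.smul_apply, hfs', smul_eq_mul]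

namespace Represents

variable {K L : HSKernel ν} {k l : S → S → ℝ}

theorem sub (hK : Represents K k) (hL : Represents L l) :
    Represents (K - L) fun s s' => k s s' - l s s' := by
  filter_upwards [Lp.coeFn_sub K L, hK, hL] with s hs hKs hLs
  rw [hs]
  filter_upwards [Lp.coeFn_sub (K s) (L s), hKs, hLs] with s' hs' hKs' hLs'
  rw [Pi.sub_apply, hs', Pi.sub_apply, hKs', hLs']

theorem const_smul (c : ℝ) (hK : Represents K k) : Represents (c • K) fun s s' => c * k s s' := by
  filter_upwards [Lp.coeFn_smul c K, hK] with s hs hKs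
  rw [hs]
  filter_upwards [Lp.coeFn_smul c (K s), hKs] with s' hs' hKs'
  rw [Pi.smul_apply, hs', Pi.smul_apply, hKs', smul_eq_mul]

theorem sum {ι : Type*} [Countable ι] {K : ι → HSKernel ν} {k : ι → S → S → ℝ}
    (hK : ∀ i, Represents (K i) (k i)) (t : Finset ι) :
    Represents (∑ i ∈ t, K i) fun s s' => ∑ i ∈ t, k i s s' := by
  filter_upwards [Lp.coeFn_finsetSum t K, ae_all_iff.2 hK] with s hs hKs
  rw [hs, Finset.sum_apply]
  filter_upwards [Lp.coeFn_finsetSum t fun i => K i s, ae_all_iff.2 hKs] with s' hs' hKs'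
  simp only [hs', Finset.sum_apply, hKs']

theorem clusterMean {m : ℕ → ℕ} {K : ℕ → ℕ → HSKernel ν} {k : ℕ → ℕ → S → S → ℝ}
    (hK : ∀ i j, Represents (K i j) (k i j)) (n : ℕ) :
    Represents (clusterMean m n K) fun s s' => clusterMean m n fun i j => k i j s s' :=
  (sum (fun i => sum (hK i) _) _).const_smul _

theorem coeFn_integralOp (hK : Represents K k) (f : Lp ℝ 2 ν) :
    integralOp ν K f =ᵐ[ν] fun s => ∫ s', k s s' * f s' ∂ν := by
  filter_upwards [HSKernel.coeFn_integralOp K f, hK] with s hs hKs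
  rw [hs, L2.inner_def]
  refine integral_congr_ae ?_
  filter_upwards [hKs] with s' hs'
  rw [hs', RCLike.inner_apply, conj_trivial]

theorem enorm_sq (hK : Represents K k) : ‖K‖ₑ ^ 2 = ∫⁻ s, ∫⁻ s', ‖k s s'‖ₑ ^ 2 ∂ν ∂ν := by
  rw [Lp.enorm_def, eLpNorm_two_sq]
  refine lintegral_congr_ae ?_
  filter_upwards [hK] with s hs
  rw [Lp.enorm_def, eLpNorm_two_sq]
  exact lintegral_congr_ae (hs.fun_comp fun r => ‖r‖ₑ ^ 2)

end Represents

variable [MeasurableSpace E] {Q : Measure E} {y : E → S → ℝ}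

theorem integrable_rankOne_sectionLp [SFinite ν] [IsSeparable ν]
    (hy : Measurable (Function.uncurry y)) (hy2 : MemLp (Function.uncurry y) 2 (Q.prod ν)) :
    Integrable (fun z => rankOne ν (sectionLp ν y z) (sectionLp ν y z)) Q :=
  memLp_one_iff_integrable.1 <|
    (rankOne ν).memLp_of_bilin 1 (memLp_sectionLp hy hy2) (memLp_sectionLp hy hy2)

theorem represents_integral_rankOne_sectionLp [IsFiniteMeasure ν] [IsSeparable ν] [SFinite Q]
    (hy : Measurable (Function.uncurry y)) (hy2 : MemLp (Function.uncurry y) 2 (Q.prod ν)) :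
    Represents (∫ z, rankOne ν (sectionLp ν y z) (sectionLp ν y z) ∂Q)
      fun s s' => ∫ z, y z s * y z s' ∂Q := by
  have hK := integrable_rankOne_sectionLp hy hy2
  have hmeas : AEStronglyMeasurable (Function.uncurry fun z s => y z s • sectionLp ν y z)
      (Q.prod ν) :=
    (hy.stronglyMeasurable.smul
      ((stronglyMeasurable_sectionLp hy).comp_measurable measurable_fst)).aestronglyMeasurable
  have hmem := ae_memLp_two_of_memLp_uncurry hy2
  have hKF : ∀ᵐ z ∂Q, rankOne ν (sectionLp ν y z) (sectionLp ν y z) =ᵐ[ν]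
      fun s => y z s • sectionLp ν y z := by
    filter_upwards [hmem] with z hz
    filter_upwards [coeFn_rankOne (sectionLp ν y z) (sectionLp ν y z), coeFn_sectionLp hz]
      with s hs hys
    rw [hs, hys]
  filter_upwards [coeFn_integral_Lp_two hK hmeas hKF,
    (integrable_uncurry_of_ae_eq_Lp_two hK hmeas hKF).prod_left_ae] with s hs hint
  rw [hs]
  refine coeFn_integral_Lp_two hint
    (((hy.comp (measurable_fst.prodMk measurable_const)).mul hy).aestronglyMeasurable) ?_
  filter_upwards [hmem] with z hz
  filter_upwards [Lp.coeFn_smul (y z s) (sectionLp ν y z), coeFn_sectionLp hz] with s' hs' hys'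
  rw [hs', Pi.smul_apply, hys', smul_eq_mul]

end HSKernel

end HilbertSchmidt

/-! ### Perturbation of eigenvalues and eigenvectors -/

section SpectralPerturbation

variable {H : Type*} [NormedAddCommGroup H] [InnerProductSpace ℝ H]

theorem inner_hilbertBasis_apply {ι : Type*} {A : H →L[ℝ] H} {b : HilbertBasis ι ℝ H} {c : ι → ℝ}
    (hA : ∀ i, A (b i) = c i • b i) (i : ι) (f : H) :
    inner ℝ (b i) (A f) = c i * inner ℝ (b i) f := by
  have hs : HasSum (fun j => inner ℝ (b i) (A (b.repr f j • b j))) (inner ℝ (b i) (A f)) :=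
    (b.hasSum_repr f).mapL ((innerSL ℝ (b i)).comp A)
  have hi : inner ℝ (b i) (A (b.repr f i • b i)) = c i * inner ℝ (b i) f := by
    rw [map_smul, hA, inner_smul_right, inner_smul_right, real_inner_self_eq_norm_sq,
      b.orthonormal.1 i, b.repr_apply_apply]
    ring
  refine hs.unique (hi ▸ hasSum_single i fun j hj => ?_)
  rw [map_smul, hA, inner_smul_right, inner_smul_right, b.orthonormal.inner_eq_zero hj.symm,
    mul_zero, mul_zero]

theorem norm_sub_le_two_mul_norm_sub_inner_smul {u v : H} (hu : ‖u‖ = 1) (hv : ‖v‖ = 1)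
    (huv : 0 ≤ inner ℝ u v) : ‖u - v‖ ≤ 2 * ‖u - (inner ℝ u v : ℝ) • v‖ := by
  have hsub : ‖u - v‖ ^ 2 = 2 - 2 * inner ℝ u v := by
    rw [norm_sub_sq_real, hu, hv]
    ring
  have hperp : ‖u - (inner ℝ u v : ℝ) • v‖ ^ 2 = 1 - inner ℝ u v ^ 2 := by
    rw [norm_sub_sq_real, inner_smul_right, norm_smul, hu, hv, Real.norm_eq_abs, mul_one, sq_abs]
    ring
  have hle : inner ℝ u v ≤ 1 := by nlinarith [sq_nonneg ‖u - v‖]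
  refine le_of_sq_le_sq ?_ (by positivity)
  rw [hsub, mul_pow, hperp]
  nlinarith [mul_nonneg huv (sub_nonneg.2 hle)]

/-- The spectral decomposition of a compact positive operator: `φ` is an orthonormal sequence of
eigenvectors of `A` with eigenvalues `lam 0 ≥ lam 1 ≥ … ≥ 0`, and `A` vanishes on its orthogonal
complement. -/
structure IsSpectralSequence (A : H →L[ℝ] H) (φ : ℕ → H) (lam : ℕ → ℝ) : Prop where
  orthonormal : Orthonormal ℝ φ
  antitone : Antitone lam
  nonneg : ∀ k, 0 ≤ lam k
  eigen : ∀ k, A (φ k) = lam k • φ k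
  complete : ∀ f, (∀ k, inner ℝ (φ k) f = 0) → A f = 0

namespace IsSpectralSequence

variable {A B : H →L[ℝ] H} {φ φ' : ℕ → H} {lam lam' : ℕ → ℝ} {k : ℕ} {f : H} {γ : ℝ}

theorem le_inner_apply_sum (h : IsSpectralSequence A φ lam) (a : Fin (k + 1) → ℝ) :
    lam k * ‖∑ l, a l • φ l‖ ^ 2 ≤ inner ℝ (∑ l, a l • φ l) (A (∑ l, a l • φ l)) := by
  have ho : Orthonormal ℝ fun l : Fin (k + 1) => φ l := h.orthonormal.comp _ Fin.val_injective
  have hA : A (∑ l, a l • φ l) = ∑ l : Fin (k + 1), (a l * lam l) • φ l := by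
    simp only [map_sum, map_smul, h.eigen, smul_smul]
  rw [hA, ← real_inner_self_eq_norm_sq, ho.inner_sum, ho.inner_sum, Finset.mul_sum]
  refine Finset.sum_le_sum fun l _ => ?_
  have hl := mul_le_mul_of_nonneg_right (h.antitone (Nat.lt_succ_iff.1 l.2)) (sq_nonneg (a l))
  simp only [conj_trivial]
  linarith

theorem exists_gap (h : IsSpectralSequence A φ lam) (hk : ∀ l, l ≠ k → lam l ≠ lam k) :
    ∃ γ, 0 < γ ∧ γ ≤ lam k ∧ ∀ l, l ≠ k → γ ≤ |lam l - lam k| := by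
  have hnext : 0 < lam k - lam (k + 1) :=
    sub_pos.2 (lt_of_le_of_ne (h.antitone k.le_succ) (hk _ k.succ_ne_self))
  have hup : ∀ l, k < l → lam k - lam (k + 1) ≤ |lam l - lam k| := fun l hl => by
    rw [abs_sub_comm]
    exact (sub_le_sub_left (h.antitone hl) _).trans (le_abs_self _)
  have hle : lam k - lam (k + 1) ≤ lam k := sub_le_self _ (h.nonneg _)
  rcases k with _ | k
  · exact ⟨_, hnext, hle, fun l hl => hup l (Nat.pos_of_ne_zero hl)⟩
  · have hprev : 0 < lam k - lam (k + 1) :=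
      sub_pos.2 (lt_of_le_of_ne (h.antitone k.le_succ) (hk _ k.succ_ne_self.symm).symm)
    refine ⟨_, lt_min hnext hprev, (min_le_left _ _).trans hle, fun l hl => ?_⟩
    rcases lt_or_gt_of_ne hl with hl | hl
    · refine (min_le_right _ _).trans (le_trans ?_ (le_abs_self _))
      exact sub_le_sub_right (h.antitone (Nat.lt_succ_iff.1 hl)) _
    · exact (min_le_left _ _).trans (hup l hl)

variable [CompleteSpace H]

theorem exists_hilbertBasis (h : IsSpectralSequence A φ lam) :
    ∃ (w : Set H) (b : HilbertBasis w ℝ H) (c : w → ℝ),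
      (∀ i f, inner ℝ (b i) (A f) = c i * inner ℝ (b i) f) ∧
      ∀ i, (∃ l, b i = φ l ∧ c i = lam l) ∨ c i = 0 := by
  obtain ⟨w, b, hw, hb⟩ := h.orthonormal.toSubtypeRange.exists_hilbertBasis_extension
  have hcase : ∀ i : w, ∃ c : ℝ,
      A (b i) = c • b i ∧ ((∃ l, b i = φ l ∧ c = lam l) ∨ c = 0) := by
    intro i
    by_cases hi : ∃ l, b i = φ l
    · obtain ⟨l, hl⟩ := hi
      exact ⟨lam l, by rw [hl, h.eigen], .inl ⟨l, hl, rfl⟩⟩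
    · refine ⟨0, ?_, .inr rfl⟩
      rw [zero_smul]
      refine h.complete _ fun l => ?_
      have hl : φ l = b ⟨φ l, hw ⟨l, rfl⟩⟩ := by rw [hb]
      rw [hl]
      exact b.orthonormal.inner_eq_zero fun heq => hi ⟨l, by rw [hl, heq]⟩
  choose c hA hc using hcase
  exact ⟨w, b, c, inner_hilbertBasis_apply hA, hc⟩

theorem inner_apply_le (h : IsSpectralSequence A φ lam) (hf : ∀ l < k, inner ℝ (φ l) f = 0) :
    inner ℝ f (A f) ≤ lam k * ‖f‖ ^ 2 := by
  obtain ⟨w, b, c, hA, hc⟩ := h.exists_hilbertBasis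
  have hcoef : ∀ i, c i * inner ℝ (b i) f ^ 2 ≤ lam k * inner ℝ (b i) f ^ 2 := by
    intro i
    rcases hc i with ⟨l, hbl, hcl⟩ | hci
    · rcases lt_or_ge l k with hl | hl
      · simp [hbl, hf l hl]
      · exact hcl ▸ mul_le_mul_of_nonneg_right (h.antitone hl) (sq_nonneg _)
    · exact hci ▸ mul_le_mul_of_nonneg_right (h.nonneg k) (sq_nonneg _)
  have hnorm := (b.hasSum_inner_mul_inner f f).mul_left (lam k)
  rw [real_inner_self_eq_norm_sq] at hnorm
  refine hasSum_le (fun i => ?_) (b.hasSum_inner_mul_inner f (A f)) hnorm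
  rw [hA, real_inner_comm (b i) f]
  linarith [hcoef i]

theorem eigenvalue_le_add_opNorm_sub (hA : IsSpectralSequence A φ lam)
    (hB : IsSpectralSequence B φ' lam') (k : ℕ) : lam k ≤ lam' k + ‖A - B‖ := by
  -- A unit vector in the span of `φ 0, …, φ k` orthogonal to `φ' 0, …, φ' (k - 1)` has Rayleigh
  -- quotient at least `lam k` for `A` and at most `lam' k` for `B`.
  let M : Matrix (Fin k) (Fin (k + 1)) ℝ := fun j l => inner ℝ (φ' j) (φ l)
  have hker : LinearMap.ker M.mulVecLin ≠ ⊥ := LinearMap.ker_ne_bot_of_finrank_lt (by simp)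
  obtain ⟨a, ha, ha0⟩ := Submodule.exists_mem_ne_zero_of_ne_bot hker
  set f : H := ∑ l, a l • φ l with hf
  have hf0 : f ≠ 0 := fun h0 => ha0 <| funext <| Fintype.linearIndependent_iff.1
    (hA.orthonormal.comp _ Fin.val_injective).linearIndependent a h0
  have hperp : ∀ l < k, inner ℝ (φ' l) f = 0 := by
    intro l hl
    have hl0 := congrFun (LinearMap.mem_ker.1 ha) ⟨l, hl⟩
    rw [Matrix.mulVecLin_apply] at hl0
    rw [hf, inner_sum]
    simpa [Matrix.mulVec, dotProduct, M, inner_smul_right, mul_comm] using hl0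
  have hlower : lam k * ‖f‖ ^ 2 ≤ inner ℝ f (A f) := hA.le_inner_apply_sum a
  have hupper : inner ℝ f (B f) ≤ lam' k * ‖f‖ ^ 2 := hB.inner_apply_le hperp
  have hdiff : inner ℝ f ((A - B) f) ≤ ‖A - B‖ * ‖f‖ ^ 2 := by
    refine (real_inner_le_norm _ _).trans ?_
    nlinarith [(A - B).le_opNorm f, norm_nonneg f]
  rw [sub_apply, inner_sub_right] at hdiff
  refine le_of_mul_le_mul_right ?_ (pow_pos (norm_pos_iff.2 hf0) 2)
  linarith

theorem abs_eigenvalue_sub_le (hA : IsSpectralSequence A φ lam)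
    (hB : IsSpectralSequence B φ' lam') (k : ℕ) : |lam' k - lam k| ≤ ‖A - B‖ :=
  abs_sub_le_iff.2 ⟨sub_le_iff_le_add'.2 (norm_sub_rev A B ▸ hB.eigenvalue_le_add_opNorm_sub hA k),
    sub_le_iff_le_add'.2 (hA.eigenvalue_le_add_opNorm_sub hB k)⟩

-- The bound `γ ≤ lam k` is the gap to the eigenvalue `0` of `A` on the complement of the `φ l`.
theorem mul_norm_le_norm_apply_sub (h : IsSpectralSequence A φ lam) (hγ0 : 0 ≤ γ)
    (hγ : γ ≤ lam k) (hgap : ∀ l, l ≠ k → γ ≤ |lam l - lam k|) (hf : inner ℝ (φ k) f = 0) :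
    γ * ‖f‖ ≤ ‖A f - lam k • f‖ := by
  obtain ⟨w, b, c, hA, hc⟩ := h.exists_hilbertBasis
  have hcoef : ∀ i, γ ^ 2 * inner ℝ (b i) f ^ 2 ≤ (c i - lam k) ^ 2 * inner ℝ (b i) f ^ 2 := by
    intro i
    rcases hc i with ⟨l, hbl, hcl⟩ | hci
    · rcases eq_or_ne l k with rfl | hl
      · simp [hbl, hf]
      · refine mul_le_mul_of_nonneg_right ?_ (sq_nonneg _)
        rw [hcl, ← sq_abs (lam l - lam k)]
        exact pow_le_pow_left₀ hγ0 (hgap l hl) 2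
    · refine mul_le_mul_of_nonneg_right ?_ (sq_nonneg _)
      rw [hci, zero_sub, neg_sq]
      exact pow_le_pow_left₀ hγ0 hγ 2
  have hnorm := (b.hasSum_inner_mul_inner f f).mul_left (γ ^ 2)
  have hres := b.hasSum_inner_mul_inner (A f - lam k • f) (A f - lam k • f)
  rw [real_inner_self_eq_norm_sq] at hnorm hres
  refine le_of_sq_le_sq ?_ (norm_nonneg _)
  rw [mul_pow]
  refine hasSum_le (fun i => ?_) hnorm hres
  rw [real_inner_comm (b i), real_inner_comm (b i), inner_sub_right, inner_smul_right, hA]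
  linarith [hcoef i]

theorem mul_norm_eigenvector_sub_le (hA : IsSpectralSequence A φ lam)
    (hB : IsSpectralSequence B φ' lam') (hγ0 : 0 ≤ γ) (hγ : γ ≤ lam k)
    (hgap : ∀ l, l ≠ k → γ ≤ |lam l - lam k|) (hsign : 0 ≤ inner ℝ (φ' k) (φ k)) :
    γ * ‖φ' k - φ k‖ ≤ 4 * ‖A - B‖ := by
  have hφ := hA.orthonormal.1 k
  have hφ' := hB.orthonormal.1 k
  set a : ℝ := inner ℝ (φ' k) (φ k)
  set r : H := φ' k - a • φ k with hr
  have hperp : inner ℝ (φ k) r = 0 := by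
    rw [hr, inner_sub_right, inner_smul_right, real_inner_self_eq_norm_sq, hφ, one_pow, mul_one,
      real_inner_comm, sub_self]
  have hres : A r - lam k • r = (A - B) (φ' k) + (lam' k - lam k) • φ' k := by
    rw [hr, map_sub, map_smul, hA.eigen, sub_apply, hB.eigen]
    module
  have hrle : γ * ‖r‖ ≤ 2 * ‖A - B‖ := calc
    _ ≤ ‖A r - lam k • r‖ := hA.mul_norm_le_norm_apply_sub hγ0 hγ hgap hperp
    _ ≤ ‖(A - B) (φ' k)‖ + ‖(lam' k - lam k) • φ' k‖ := hres ▸ norm_add_le _ _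
    _ ≤ ‖A - B‖ * ‖φ' k‖ + ‖A - B‖ * ‖φ' k‖ := by
      gcongr
      · exact (A - B).le_opNorm _
      · rw [norm_smul]
        gcongr
        exact hA.abs_eigenvalue_sub_le hB k
    _ = 2 * ‖A - B‖ := by rw [hφ', mul_one, two_mul]
  calc
    _ ≤ γ * (2 * ‖r‖) := by
      gcongr
      exact norm_sub_le_two_mul_norm_sub_inner_smul hφ' hφ hsign
    _ ≤ 4 * ‖A - B‖ := by linarith

end IsSpectralSequence

end SpectralPerturbation

/-! ### The longitudinal model -/

section Probability

variable {Ω : Type*} [MeasurableSpace Ω] {μ : Measure Ω}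

theorem indepFun_prodMk_transpose {α₁ α₂ β₁ β₂ : Type*}
    [MeasurableSpace α₁] [MeasurableSpace α₂] [MeasurableSpace β₁] [MeasurableSpace β₂]
    [IsProbabilityMeasure μ] {A₁ : Ω → α₁} {A₂ : Ω → α₂} {B₁ : Ω → β₁} {B₂ : Ω → β₂}
    (hA₁ : Measurable A₁) (hA₂ : Measurable A₂) (hB₁ : Measurable B₁) (hB₂ : Measurable B₂)
    (hAB : IndepFun (fun ω => (A₁ ω, A₂ ω)) (fun ω => (B₁ ω, B₂ ω)) μ)
    (hA : IndepFun A₁ A₂ μ) (hB : IndepFun B₁ B₂ μ) :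
    IndepFun (fun ω => (A₁ ω, B₁ ω)) (fun ω => (A₂ ω, B₂ ω)) μ := by
  have hAB₁ : IndepFun A₁ B₁ μ := hAB.comp measurable_fst measurable_fst
  have hAB₂ : IndepFun A₂ B₂ μ := hAB.comp measurable_snd measurable_snd
  refine IndepSets.indep (hA₁.prodMk hB₁).comap_le (hA₂.prodMk hB₂).comap_le
    ((isPiSystem_prod (α := α₁) (β := β₁)).comap fun ω => (A₁ ω, B₁ ω))
    ((isPiSystem_prod (α := α₂) (β := β₂)).comap fun ω => (A₂ ω, B₂ ω)) ?_ ?_ ?_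
  · rw [← generateFrom_prod, MeasurableSpace.comap_generateFrom]
    rfl
  · rw [← generateFrom_prod, MeasurableSpace.comap_generateFrom]
    rfl
  · rw [IndepSets_iff]
    rintro _ _ ⟨_, ⟨s, hs, u, hu, rfl⟩, rfl⟩ ⟨_, ⟨s', hs', u', hu', rfl⟩, rfl⟩
    simp only [Set.mem_ofPred_eq] at hs hu hs' hu'
    have hswap : (fun ω => (A₁ ω, B₁ ω)) ⁻¹' s ×ˢ u ∩ (fun ω => (A₂ ω, B₂ ω)) ⁻¹' s' ×ˢ u' =
        (fun ω => (A₁ ω, A₂ ω)) ⁻¹' s ×ˢ s' ∩ (fun ω => (B₁ ω, B₂ ω)) ⁻¹' u ×ˢ u' := by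
      ext ω
      simp only [Set.mem_inter_iff, Set.mem_preimage, Set.mem_prod]
      tauto
    rw [hswap, hAB.measure_inter_preimage_eq_mul _ _ (hs.prod hs') (hu.prod hu')]
    simp only [Set.mk_preimage_prod]
    rw [hA.measure_inter_preimage_eq_mul _ _ hs hs', hB.measure_inter_preimage_eq_mul _ _ hu hu',
      hAB₁.measure_inter_preimage_eq_mul _ _ hs hu, hAB₂.measure_inter_preimage_eq_mul _ _ hs' hu']
    ring

theorem tendstoInMeasure_zero_of_norm_le_mul {F G : Type*} [NormedAddCommGroup F]
    [NormedAddCommGroup G] [IsFiniteMeasure μ] {R : Ω → ℝ} (hR : AEStronglyMeasurable R μ)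
    {a : ℕ → Ω → F} {A : Ω → F} (ha : ∀ n, AEStronglyMeasurable (a n) μ)
    (haA : TendstoInMeasure μ a atTop A) {b : ℕ → Ω → G}
    (hb : ∀ n, ∀ᵐ ω ∂μ, ‖b n ω‖ ≤ R ω * ‖a n ω - A ω‖) :
    TendstoInMeasure μ b atTop fun _ => 0 := by
  have hprod : TendstoInMeasure μ (fun n ω => R ω * ‖a n ω - A ω‖) atTop fun _ => 0 := by
    have hmeas : ∀ n, AEStronglyMeasurable (fun ω => R ω * ‖a n ω - A ω‖) μ := fun n =>
      hR.mul ((ha n).sub (haA.aestronglyMeasurable ha)).norm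
    refine (exists_seq_tendstoInMeasure_atTop_iff hmeas).2 fun ns hns => ?_
    obtain ⟨ns', hns', hlim⟩ := (exists_seq_tendstoInMeasure_atTop_iff ha).1 haA ns hns
    refine ⟨ns', hns', ?_⟩
    filter_upwards [hlim] with ω hω
    simpa using (tendsto_iff_norm_sub_tendsto_zero.1 hω).const_mul (R ω)
  rw [tendstoInMeasure_iff_norm] at hprod ⊢
  refine fun δ hδ => tendsto_of_tendsto_of_tendsto_of_le_of_le tendsto_const_nhds (hprod δ hδ)
    (fun _ => zero_le) fun n => measure_mono_ae ?_
  filter_upwards [hb n] with ω hω (hδb : δ ≤ ‖b n ω - 0‖)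
  rw [sub_zero] at hδb
  change δ ≤ ‖R ω * ‖a n ω - A ω‖ - 0‖
  rw [sub_zero]
  exact hδb.trans (hω.trans (le_abs_self _))

end Probability

section Visit

variable {Ω 𝓧 𝓔 : Type*}

/-- The process, visit time and error of the `j`-th visit of subject `i`. -/
abbrev visit (x : ℕ → Ω → 𝓧) (T : ℕ → ℕ → Ω → unitInterval) (ε : ℕ → ℕ → Ω → 𝓔)
    (i j : ℕ) (ω : Ω) : 𝓧 × unitInterval × 𝓔 :=
  (x i ω, T i j ω, ε i j ω)

/-- The curve `X(·, t) + e` observed at the visit `z = (X, t, e)`. -/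
def visitCurve (X : 𝓧 → unitInterval → unitInterval → ℝ) (e : 𝓔 → unitInterval → ℝ)
    (z : 𝓧 × unitInterval × 𝓔) (s : unitInterval) : ℝ :=
  X z.1 s z.2.1 + e z.2.2 s

/-- The distribution of the visit times. -/
abbrev timeLaw (g : unitInterval → ℝ) : Measure unitInterval :=
  (volume : Measure unitInterval).withDensity fun t => ENNReal.ofReal (g t)

/-- The distribution of a visit. -/
abbrev visitLaw [MeasurableSpace 𝓧] [MeasurableSpace 𝓔] (PX : Measure 𝓧) (PE : Measure 𝓔)
    (g : unitInterval → ℝ) : Measure (𝓧 × unitInterval × 𝓔) :=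
  PX.prod ((timeLaw g).prod PE)

/-- The kernel `(s, s') ↦ Y(s) Y(s')` of the curve `Y` observed at a visit, with the junk value `0`
if `Y` is not square integrable. -/
def visitKernel (X : 𝓧 → unitInterval → unitInterval → ℝ) (e : 𝓔 → unitInterval → ℝ)
    (z : 𝓧 × unitInterval × 𝓔) : HSKernel (volume : Measure unitInterval) :=
  HSKernel.rankOne volume (sectionLp volume (visitCurve X e) z)
    (sectionLp volume (visitCurve X e) z)

theorem pooledCov_eq_clusterMean (X : 𝓧 → unitInterval → unitInterval → ℝ)
    (e : 𝓔 → unitInterval → ℝ) (m : ℕ → ℕ) (x : ℕ → Ω → 𝓧) (T : ℕ → ℕ → Ω → unitInterval)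
    (ε : ℕ → ℕ → Ω → 𝓔) (n : ℕ) (ω : Ω) (s s' : unitInterval) :
    pooledCov (observedCurve X e x T ε) m n ω s s' = clusterMean m n fun i j =>
      visitCurve X e (visit x T ε i j ω) s * visitCurve X e (visit x T ε i j ω) s' :=
  div_eq_inv_mul _ _

end Visit

section Kernel

theorem hsNorm_eq_enorm {K : HSKernel (volume : Measure unitInterval)}
    {k : unitInterval → unitInterval → ℝ} (hK : HSKernel.Represents K k) : hsNorm k = ‖K‖ₑ := by
  rw [hsNorm, ← hK.enorm_sq, ← ENNReal.rpow_natCast, ← ENNReal.rpow_mul]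
  norm_num

theorem isSpectralSequence_integralOp {K : HSKernel (volume : Measure unitInterval)}
    {k : unitInterval → unitInterval → ℝ} (hK : HSKernel.Represents K k)
    {φ : ℕ → Lp ℝ 2 (volume : Measure unitInterval)} {lam : ℕ → ℝ}
    (h : IsSpectralDecomposition k φ lam) :
    IsSpectralSequence (HSKernel.integralOp volume K) φ lam where
  orthonormal := h.orthonormal
  antitone := h.antitone
  nonneg := h.nonneg
  eigen l := by
    refine Lp.ext ?_
    filter_upwards [hK.coeFn_integralOp (φ l), Lp.coeFn_smul (lam l) (φ l), h.eigen l]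
      with s hKs hsmul heigen
    rw [hKs, hsmul, heigen, Pi.smul_apply, smul_eq_mul]
  complete f hf := by
    refine Lp.ext ?_
    filter_upwards [hK.coeFn_integralOp f, Lp.coeFn_zero ℝ 2 (volume : Measure unitInterval),
      h.complete f hf] with s hKs hzero hcompl
    rw [hKs, hzero, hcompl, Pi.zero_apply]

theorem abs_score_sub_score_le {E : Type*} {y : E → unitInterval → ℝ} {z : E}
    (h : MemLp (y z) 2 volume) (φ φ' : Lp ℝ 2 (volume : Measure unitInterval)) :
    |score (y z) φ' - score (y z) φ| ≤ ‖sectionLp volume y z‖ * ‖φ' - φ‖ := by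
  rw [score, score, ← inner_sectionLp h, ← inner_sectionLp h, ← inner_sub_left, mul_comm]
  exact abs_real_inner_le_norm _ _

end Kernel

namespace LongitudinalModel

variable {Ω 𝓧 𝓔 : Type*} [MeasurableSpace Ω] [MeasurableSpace 𝓧] [MeasurableSpace 𝓔]
  {μ : Measure Ω} {PX : Measure 𝓧} {PE : Measure 𝓔}
  {X : 𝓧 → unitInterval → unitInterval → ℝ} {e : 𝓔 → unitInterval → ℝ}
  {g : unitInterval → ℝ} {m : ℕ → ℕ}
  {x : ℕ → Ω → 𝓧} {T : ℕ → ℕ → Ω → unitInterval} {ε : ℕ → ℕ → Ω → 𝓔}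
  (hmodel : LongitudinalModel μ PX PE X e g m x T ε)

include hmodel

theorem measurable_visitCurve : Measurable (Function.uncurry (visitCurve X e)) :=
  (hmodel.measurable_X.comp (measurable_fst.fst.prodMk
      (measurable_snd.prodMk measurable_fst.snd.fst))).add
    (hmodel.measurable_e.comp (measurable_fst.snd.snd.prodMk measurable_snd))

theorem cov_X_eq (s t s' t' : unitInterval) :
    cov[fun u => X u s t, fun u => X u s' t'; PX] = ∫ u, X u s t * X u s' t' ∂PX := by
  simp [covariance, hmodel.mean_X]

theorem errorCov_eq (s s' : unitInterval) : errorCov PE e s s' = ∫ v, e v s * e v s' ∂PE := by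
  simp [errorCov, covariance, hmodel.mean_e]

theorem memLp_X_prod [SFinite PX] (ρ : Measure (unitInterval × unitInterval)) [IsFiniteMeasure ρ] :
    MemLp (fun q : 𝓧 × unitInterval × unitInterval => X q.1 q.2.1 q.2.2) 2 (PX.prod ρ) := by
  have hX := hmodel.measurable_X
  rw [memLp_two_iff_integrable_sq hX.aestronglyMeasurable,
    integrable_prod_iff' (hX.pow_const 2).aestronglyMeasurable]
  refine ⟨ae_of_all _ fun p => (hmodel.memLp_X p.1 p.2).integrable_sq, ?_⟩
  have hvar : (fun p : unitInterval × unitInterval => ∫ u, ‖X u p.1 p.2 ^ 2‖ ∂PX) =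
      fun p => cov[fun u => X u p.1 p.2, fun u => X u p.1 p.2; PX] := by
    ext p
    simp only [hmodel.cov_X_eq, ← sq, norm_pow, Real.norm_eq_abs, sq_abs]
  rw [hvar]
  have hcont := hmodel.continuous_cov.comp (continuous_id.prodMk continuous_id)
  exact hcont.integrable_of_hasCompactSupport (HasCompactSupport.of_compactSpace _)

section Law

variable [IsProbabilityMeasure μ]

theorem isProbabilityMeasure_timeLaw : IsProbabilityMeasure (timeLaw g) :=
  isProbabilityMeasure_of_measurePreserving ⟨hmodel.measurable_T 0 0, hmodel.map_T 0 0⟩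

theorem measurePreserving_visit (i j : ℕ) :
    MeasurePreserving (visit x T ε i j) μ (visitLaw PX PE g) := by
  have hTε : IndepFun (T i j) (ε i j) μ :=
    hmodel.indep_T_ε.comp (measurable_pi_apply (i, j)) (measurable_pi_apply (i, j))
  have hx : IndepFun (x i) (fun ω => (T i j ω, ε i j ω)) μ :=
    hmodel.indep_x_Tε.comp (measurable_pi_apply i) (measurable_pi_apply (i, j))
  have mT := hmodel.measurable_T i j
  have mε := hmodel.measurable_ε i j
  have mx := hmodel.measurable_x i
  refine ⟨mx.prodMk (mT.prodMk mε), ?_⟩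
  rw [(indepFun_iff_map_prod_eq_prod_map_map mx.aemeasurable (mT.prodMk mε).aemeasurable).1 hx,
    (indepFun_iff_map_prod_eq_prod_map_map mT.aemeasurable mε.aemeasurable).1 hTε,
    hmodel.map_x, hmodel.map_T, hmodel.map_ε]

theorem indepFun_visit (i i' j j' : ℕ) (hi : i ≠ i') :
    IndepFun (visit x T ε i j) (visit x T ε i' j') μ := by
  have hne : (i, j) ≠ (i', j') := fun h => hi (congrArg Prod.fst h)
  have hTε : IndepFun (fun ω => (T i j ω, T i' j' ω)) (fun ω => (ε i j ω, ε i' j' ω)) μ :=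
    hmodel.indep_T_ε.comp ((measurable_pi_apply (i, j)).prodMk (measurable_pi_apply (i', j')))
      ((measurable_pi_apply (i, j)).prodMk (measurable_pi_apply (i', j')))
  have hx : IndepFun (fun ω => (x i ω, x i' ω))
      (fun ω => ((T i j ω, ε i j ω), (T i' j' ω, ε i' j' ω))) μ :=
    hmodel.indep_x_Tε.comp ((measurable_pi_apply i).prodMk (measurable_pi_apply i'))
      ((measurable_pi_apply (i, j)).prodMk (measurable_pi_apply (i', j')))
  have mT := hmodel.measurable_T
  have mε := hmodel.measurable_ε
  exact indepFun_prodMk_transpose (hmodel.measurable_x i) (hmodel.measurable_x i')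
    ((mT i j).prodMk (mε i j)) ((mT i' j').prodMk (mε i' j')) hx (hmodel.indep_x.indepFun hi)
    (indepFun_prodMk_transpose (mT i j) (mT i' j') (mε i j) (mε i' j') hTε
      (hmodel.indep_T.indepFun hne) (hmodel.indep_ε.indepFun hne))

variable [IsProbabilityMeasure PX] [IsProbabilityMeasure PE]

theorem memLp_X_visit (s : unitInterval) :
    MemLp (fun z : 𝓧 × unitInterval × 𝓔 => X z.1 s z.2.1) 2 (visitLaw PX PE g) := by
  have := hmodel.isProbabilityMeasure_timeLaw
  have hs : MeasurePreserving (Prod.mk s) (timeLaw g) ((timeLaw g).map (Prod.mk s)) :=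
    ⟨measurable_prodMk_left, rfl⟩
  have := isProbabilityMeasure_of_measurePreserving hs
  exact (hmodel.memLp_X_prod _).comp_measurePreserving
    ((MeasurePreserving.id PX).prod (hs.comp measurePreserving_fst))

theorem memLp_e_visit (s : unitInterval) :
    MemLp (fun z : 𝓧 × unitInterval × 𝓔 => e z.2.2 s) 2 (visitLaw PX PE g) := by
  have := hmodel.isProbabilityMeasure_timeLaw
  exact (hmodel.memLp_e s).comp_measurePreserving
    (measurePreserving_snd.comp measurePreserving_snd)

theorem integrable_visitCurve_mul (s s' : unitInterval) :
    Integrable (fun z => visitCurve X e z s * visitCurve X e z s') (visitLaw PX PE g) :=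
  ((hmodel.memLp_X_visit s).add (hmodel.memLp_e_visit s)).integrable_mul
    ((hmodel.memLp_X_visit s').add (hmodel.memLp_e_visit s'))

theorem integral_X_mul_X_visit (hg : Measurable g) (s s' : unitInterval) :
    ∫ z, X z.1 s z.2.1 * X z.1 s' z.2.1 ∂(visitLaw PX PE g) = marginalCov PX X g s s' := by
  have := hmodel.isProbabilityMeasure_timeLaw
  calc
    _ = ∫ w : unitInterval × 𝓔, ∫ u, X u s w.1 * X u s' w.1 ∂PX ∂(timeLaw g).prod PE :=
      integral_prod_symm _ ((hmodel.memLp_X_visit s).integrable_mul (hmodel.memLp_X_visit s'))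
    _ = ∫ t, ∫ u, X u s t * X u s' t ∂PX ∂timeLaw g := by
      rw [integral_fun_fst (fun t => ∫ u, X u s t * X u s' t ∂PX), probReal_univ, one_smul]
    _ = marginalCov PX X g s s' := by
      rw [timeLaw, integral_withDensity_eq_integral_toReal_smul hg.ennreal_ofReal
        (ae_of_all _ fun _ => ENNReal.ofReal_lt_top), marginalCov]
      refine integral_congr_ae (ae_of_all _ fun t => ?_)
      simp only [hmodel.cov_X_eq, ENNReal.toReal_ofReal (hmodel.g_nonneg t), smul_eq_mul, mul_comm]

theorem integral_X_mul_e_visit (s s' : unitInterval) :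
    ∫ z, X z.1 s z.2.1 * e z.2.2 s' ∂(visitLaw PX PE g) = 0 := by
  have := hmodel.isProbabilityMeasure_timeLaw
  refine (integral_prod_symm _
    ((hmodel.memLp_X_visit s).integrable_mul (hmodel.memLp_e_visit s'))).trans ?_
  simp [integral_mul_const, hmodel.mean_X]

theorem integral_e_mul_e_visit (s s' : unitInterval) :
    ∫ z, e z.2.2 s * e z.2.2 s' ∂(visitLaw PX PE g) = errorCov PE e s s' := by
  have := hmodel.isProbabilityMeasure_timeLaw
  rw [integral_fun_snd fun w : unitInterval × 𝓔 => e w.2 s * e w.2 s',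
    integral_fun_snd fun v => e v s * e v s', hmodel.errorCov_eq]
  simp only [probReal_univ, one_smul]

theorem integral_visitCurve_mul (hg : Measurable g) (s s' : unitInterval) :
    ∫ z, visitCurve X e z s * visitCurve X e z s' ∂(visitLaw PX PE g) =
      totalCov PX PE X e g s s' := by
  have hXX : Integrable (fun z : 𝓧 × unitInterval × 𝓔 => X z.1 s z.2.1 * X z.1 s' z.2.1)
      (visitLaw PX PE g) := (hmodel.memLp_X_visit s).integrable_mul (hmodel.memLp_X_visit s')
  have hXe : ∀ r r', Integrable (fun z : 𝓧 × unitInterval × 𝓔 => X z.1 r z.2.1 * e z.2.2 r')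
      (visitLaw PX PE g) := fun r r' =>
    (hmodel.memLp_X_visit r).integrable_mul (hmodel.memLp_e_visit r')
  have hee : Integrable (fun z : 𝓧 × unitInterval × 𝓔 => e z.2.2 s * e z.2.2 s')
      (visitLaw PX PE g) := (hmodel.memLp_e_visit s).integrable_mul (hmodel.memLp_e_visit s')
  have hexpand : ∀ z : 𝓧 × unitInterval × 𝓔, visitCurve X e z s * visitCurve X e z s' =
      X z.1 s z.2.1 * X z.1 s' z.2.1 + X z.1 s z.2.1 * e z.2.2 s' +
        (X z.1 s' z.2.1 * e z.2.2 s + e z.2.2 s * e z.2.2 s') := fun z => by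
    simp only [visitCurve]
    ring
  calc
    _ = ∫ z : 𝓧 × unitInterval × 𝓔,
          X z.1 s z.2.1 * X z.1 s' z.2.1 + X z.1 s z.2.1 * e z.2.2 s' ∂(visitLaw PX PE g) +
        ∫ z : 𝓧 × unitInterval × 𝓔,
          X z.1 s' z.2.1 * e z.2.2 s + e z.2.2 s * e z.2.2 s' ∂(visitLaw PX PE g) := by
      simp only [hexpand]
      exact integral_add (hXX.add (hXe s s')) ((hXe s' s).add hee)
    _ = totalCov PX PE X e g s s' := by
      rw [integral_add hXX (hXe s s'), integral_add (hXe s' s) hee,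
        hmodel.integral_X_mul_X_visit hg, hmodel.integral_X_mul_e_visit,
        hmodel.integral_X_mul_e_visit, hmodel.integral_e_mul_e_visit, add_zero, zero_add, totalCov]

theorem tendstoInMeasure_pooledCov (hg : Measurable g) (s s' : unitInterval) :
    TendstoInMeasure μ (fun n ω => pooledCov (observedCurve X e x T ε) m n ω s s') atTop
      (fun _ => totalCov PX PE X e g s s') := by
  simp only [pooledCov_eq_clusterMean, ← hmodel.integral_visitCurve_mul hg]
  exact tendstoInMeasure_clusterMean (F := fun z => visitCurve X e z s * visitCurve X e z s')
    hmodel.sparse hmodel.measurePreserving_visit hmodel.indepFun_visit hmodel.one_le_m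
    (hmodel.integrable_visitCurve_mul s s')

end Law

section Kernel

variable [IsProbabilityMeasure μ] [IsProbabilityMeasure PX] [IsProbabilityMeasure PE]
  (he2 : (∫⁻ v, (∫⁻ s, ‖e v s‖ₑ ^ 2) ∂PE) < ∞)

include he2

theorem memLp_uncurry_visitCurve :
    MemLp (Function.uncurry (visitCurve X e)) 2 ((visitLaw PX PE g).prod volume) := by
  have := hmodel.isProbabilityMeasure_timeLaw
  have he : MemLp (Function.uncurry e) 2 (PE.prod volume) := by
    have hsq : eLpNorm (Function.uncurry e) 2 (PE.prod volume) ^ 2 < ∞ := by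
      rw [eLpNorm_two_sq]
      exact (lintegral_prod _
        (hmodel.measurable_e.enorm.pow_const 2).aemeasurable).trans_lt he2
    exact ⟨hmodel.measurable_e.aestronglyMeasurable,
      (ENNReal.pow_lt_top_iff.1 hsq).resolve_right two_ne_zero⟩
  have htime : MeasurePreserving (fun q : (unitInterval × 𝓔) × unitInterval => (q.2, q.1.1))
      (((timeLaw g).prod PE).prod volume) (volume.prod (timeLaw g)) :=
    Measure.measurePreserving_swap.comp (measurePreserving_fst.prod (MeasurePreserving.id volume))
  exact ((hmodel.memLp_X_prod _).comp_measurePreserving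
      (((MeasurePreserving.id PX).prod htime).comp (measurePreserving_prodAssoc _ _ _))).add
    (he.comp_measurePreserving
      ((measurePreserving_snd.comp measurePreserving_snd).prod (MeasurePreserving.id volume)))

theorem represents_integral_visitKernel (hg : Measurable g) :
    HSKernel.Represents (∫ z, visitKernel X e z ∂visitLaw PX PE g) (totalCov PX PE X e g) := by
  have := hmodel.isProbabilityMeasure_timeLaw
  have h := HSKernel.represents_integral_rankOne_sectionLp hmodel.measurable_visitCurve
    (hmodel.memLp_uncurry_visitCurve he2)
  simp only [hmodel.integral_visitCurve_mul hg] at h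
  exact h

theorem integrable_visitKernel : Integrable (visitKernel X e) (visitLaw PX PE g) := by
  have := hmodel.isProbabilityMeasure_timeLaw
  exact HSKernel.integrable_rankOne_sectionLp hmodel.measurable_visitCurve
    (hmodel.memLp_uncurry_visitCurve he2)

theorem ae_memLp_visitCurve :
    ∀ᵐ ω ∂μ, ∀ i j, MemLp (visitCurve X e (visit x T ε i j ω)) 2 volume :=
  have := hmodel.isProbabilityMeasure_timeLaw
  ae_all_iff.2 fun i => ae_all_iff.2 fun j =>
    (hmodel.measurePreserving_visit i j).quasiMeasurePreserving.ae
      (ae_memLp_two_of_memLp_uncurry (hmodel.memLp_uncurry_visitCurve he2))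

theorem ae_represents_clusterMean_visitKernel :
    ∀ᵐ ω ∂μ, ∀ n, HSKernel.Represents
      (clusterMean m n fun i j => visitKernel X e (visit x T ε i j ω))
      (pooledCov (observedCurve X e x T ε) m n ω) := by
  filter_upwards [hmodel.ae_memLp_visitCurve he2] with ω hω n
  have hcoe := fun i j => coeFn_sectionLp (hω i j)
  have hpooled : pooledCov (observedCurve X e x T ε) m n ω = fun s s' => clusterMean m n fun i j =>
      visitCurve X e (visit x T ε i j ω) s * visitCurve X e (visit x T ε i j ω) s' := by
    ext s s'
    exact pooledCov_eq_clusterMean X e m x T ε n ω s s'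
  rw [hpooled]
  exact HSKernel.Represents.clusterMean
    (fun i j => HSKernel.represents_rankOne (hcoe i j) (hcoe i j)) n

theorem aestronglyMeasurable_clusterMean_visitKernel (n : ℕ) :
    AEStronglyMeasurable
      (fun ω => clusterMean m n fun i j => visitKernel X e (visit x T ε i j ω)) μ :=
  aestronglyMeasurable_clusterMean (fun i j => (hmodel.integrable_visitKernel he2).1
    |>.comp_measurePreserving (hmodel.measurePreserving_visit i j)) n

theorem tendstoInMeasure_clusterMean_visitKernel :
    TendstoInMeasure μ
      (fun n ω => clusterMean m n fun i j => visitKernel X e (visit x T ε i j ω)) atTop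
      (fun _ => ∫ z, visitKernel X e z ∂visitLaw PX PE g) :=
  tendstoInMeasure_clusterMean hmodel.sparse hmodel.measurePreserving_visit
    hmodel.indepFun_visit hmodel.one_le_m (hmodel.integrable_visitKernel he2)

theorem tendsto_measure_hsNorm_pooledCov_sub (hg : Measurable g) {δ : ℝ≥0∞} (hδ : 0 < δ) :
    Tendsto (fun n => μ {ω | δ ≤ hsNorm fun s s' =>
      pooledCov (observedCurve X e x T ε) m n ω s s' - totalCov PX PE X e g s s'})
      atTop (𝓝 0) := by
  refine (hmodel.tendstoInMeasure_clusterMean_visitKernel he2 δ hδ).congr fun n =>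
    measure_congr ?_
  filter_upwards [hmodel.ae_represents_clusterMean_visitKernel he2] with ω hω
  have hnorm := hsNorm_eq_enorm ((hω n).sub (hmodel.represents_integral_visitKernel he2 hg))
  rw [← edist_eq_enorm_sub] at hnorm
  exact congrArg (δ ≤ ·) hnorm.symm

variable {φ : ℕ → Lp ℝ 2 (volume : Measure unitInterval)} {lam : ℕ → ℝ}
  {φhat : ℕ → Ω → ℕ → Lp ℝ 2 (volume : Measure unitInterval)} {lamhat : ℕ → Ω → ℕ → ℝ}
  (hφ : IsSpectralDecomposition (totalCov PX PE X e g) φ lam)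
  (hφhat : ∀ n, ∀ᵐ ω ∂μ, IsSpectralDecomposition
    (pooledCov (observedCurve X e x T ε) m n ω) (φhat n ω) (lamhat n ω))
  {k : ℕ} (hk : ∀ l, l ≠ k → lam l ≠ lam k)
  (hsign : ∀ n, ∀ᵐ ω ∂μ, 0 ≤ inner ℝ (φhat n ω k) (φ k))

include hφ hφhat hk hsign

theorem exists_norm_eigenfunction_sub_le (hg : Measurable g) :
    ∃ C : ℝ, ∀ n, ∀ᵐ ω ∂μ, ‖φhat n ω k - φ k‖ ≤
      C * ‖(clusterMean m n fun i j => visitKernel X e (visit x T ε i j ω)) -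
        ∫ z, visitKernel X e z ∂visitLaw PX PE g‖ := by
  have hA := isSpectralSequence_integralOp (hmodel.represents_integral_visitKernel he2 hg) hφ
  obtain ⟨γ, hγ0, hγ, hgap⟩ := hA.exists_gap hk
  refine ⟨4 / γ, fun n => ?_⟩
  filter_upwards [hmodel.ae_represents_clusterMean_visitKernel he2, hφhat n, hsign n]
    with ω hω hdec hs
  have hB := isSpectralSequence_integralOp (hω n) hdec
  have hle := hA.mul_norm_eigenvector_sub_le hB hγ0.le hγ hgap hs
  rw [← map_sub] at hle
  rw [div_mul_eq_mul_div, le_div_iff₀' hγ0, norm_sub_rev (clusterMean _ _ _)]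
  exact hle.trans (by gcongr; exact HSKernel.norm_integralOp_le _)

theorem tendstoInMeasure_iSup_abs_score_sub (hg : Measurable g) (i : ℕ) :
    TendstoInMeasure μ (fun n ω => ⨆ j : Fin (m i),
      |score (observedCurve X e x T ε i j ω) (φhat n ω k) -
        score (observedCurve X e x T ε i j ω) (φ k)|) atTop (fun _ => 0) := by
  obtain ⟨C, hC⟩ := hmodel.exists_norm_eigenfunction_sub_le he2 hφ hφhat hk hsign hg
  let Y : ℕ → Ω → Lp ℝ 2 (volume : Measure unitInterval) := fun j ω =>
    sectionLp volume (visitCurve X e) (visit x T ε i j ω)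
  have hY : ∀ j, AEStronglyMeasurable (Y j) μ := fun j =>
    (stronglyMeasurable_sectionLp hmodel.measurable_visitCurve).aestronglyMeasurable
      |>.comp_measurePreserving (hmodel.measurePreserving_visit i j)
  refine tendstoInMeasure_zero_of_norm_le_mul (R := fun ω => (∑ j : Fin (m i), ‖Y j ω‖) * C)
    ((Finset.aestronglyMeasurable_fun_sum Finset.univ fun (j : Fin (m i)) _ =>
      (hY j).norm).mul_const C)
    (hmodel.aestronglyMeasurable_clusterMean_visitKernel he2)
    (hmodel.tendstoInMeasure_clusterMean_visitKernel he2) fun n => ?_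
  filter_upwards [hmodel.ae_memLp_visitCurve he2, hC n] with ω hω hCω
  have hsum : 0 ≤ ∑ j : Fin (m i), ‖Y j ω‖ := Finset.sum_nonneg fun j _ => norm_nonneg _
  rw [Real.norm_of_nonneg (Real.iSup_nonneg fun _ => abs_nonneg _), mul_assoc]
  refine Real.iSup_le (fun j => ?_) (mul_nonneg hsum ((norm_nonneg _).trans hCω))
  calc
    _ ≤ ‖Y j ω‖ * ‖φhat n ω k - φ k‖ := abs_score_sub_score_le (hω i j) (φ k) (φhat n ω k)
    _ ≤ _ := mul_le_mul (Finset.single_le_sum (f := fun j : Fin (m i) => ‖Y j ω‖)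
      (fun _ _ => norm_nonneg _) (Finset.mem_univ j)) hCω (norm_nonneg _) hsum

end Kernel

end LongitudinalModel

end

theorem corollary3_general {Ω 𝓧 𝓔 : Type*}
    [MeasurableSpace Ω] [MeasurableSpace 𝓧] [MeasurableSpace 𝓔]
    (μ : Measure Ω) [IsProbabilityMeasure μ]
    (PX : Measure 𝓧) [IsProbabilityMeasure PX] (PE : Measure 𝓔) [IsProbabilityMeasure PE]
    (X : 𝓧 → unitInterval → unitInterval → ℝ) (e : 𝓔 → unitInterval → ℝ)
    (g : unitInterval → ℝ) (m : ℕ → ℕ)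
    (x : ℕ → Ω → 𝓧) (T : ℕ → ℕ → Ω → unitInterval) (ε : ℕ → ℕ → Ω → 𝓔)
    (hmodel : LongitudinalModel μ PX PE X e g m x T ε)
    (hg : Measurable g) :
    (∀ s s', TendstoInMeasure μ
      (fun n ω => pooledCov (observedCurve X e x T ε) m n ω s s') atTop
      (fun _ => totalCov PX PE X e g s s')) ∧
    ((∫⁻ v, (∫⁻ s, ‖e v s‖ₑ ^ 2) ∂PE) < ∞ →
      (∀ δ : ℝ≥0∞, 0 < δ → Tendsto (fun n => μ {ω | δ ≤ hsNorm fun s s' =>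
          pooledCov (observedCurve X e x T ε) m n ω s s' - totalCov PX PE X e g s s'})
        atTop (𝓝 0)) ∧
      ∀ (φ : ℕ → Lp ℝ 2 (volume : Measure unitInterval)) (lam : ℕ → ℝ)
        (φhat : ℕ → Ω → ℕ → Lp ℝ 2 (volume : Measure unitInterval)) (lamhat : ℕ → Ω → ℕ → ℝ),
        IsSpectralDecomposition (totalCov PX PE X e g) φ lam →
        (∀ n, ∀ᵐ ω ∂μ, IsSpectralDecomposition
          (pooledCov (observedCurve X e x T ε) m n ω) (φhat n ω) (lamhat n ω)) →
        ∀ k, (∀ l, l ≠ k → lam l ≠ lam k) →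
          (∀ n, ∀ᵐ ω ∂μ, 0 ≤ inner ℝ (φhat n ω k) (φ k)) →
          ∀ i, TendstoInMeasure μ
            (fun n ω => ⨆ j : Fin (m i),
              |score (observedCurve X e x T ε i j ω) (φhat n ω k) -
                score (observedCurve X e x T ε i j ω) (φ k)|) atTop
            (fun _ => 0)) :=
  ⟨hmodel.tendstoInMeasure_pooledCov hg, fun he2 =>
    ⟨fun _ => hmodel.tendsto_measure_hsNorm_pooledCov_sub he2 hg,
      fun _ _ _ _ hφ hφhat _ hk hsign =>
        hmodel.tendstoInMeasure_iSup_abs_score_sub he2 hφ hφhat hk hsign hg⟩⟩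

theorem corollary3 {Ω 𝓧 𝓔 : Type*}
    [MeasurableSpace Ω] [MeasurableSpace 𝓧] [MeasurableSpace 𝓔]
    (μ : Measure Ω) [IsProbabilityMeasure μ]
    (PX : Measure 𝓧) [IsProbabilityMeasure PX] (PE : Measure 𝓔) [IsProbabilityMeasure PE]
    (X : 𝓧 → unitInterval → unitInterval → ℝ) (e : 𝓔 → unitInterval → ℝ)
    (g : unitInterval → ℝ) (m : ℕ → ℕ)
    (x : ℕ → Ω → 𝓧) (T : ℕ → ℕ → Ω → unitInterval) (ε : ℕ → ℕ → Ω → 𝓔)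
    (hmodel : LongitudinalModel μ PX PE X e g m x T ε)
    -- `E ∬ X² < ∞`
    (hX2 : (∫⁻ u, (∫⁻ s, ∫⁻ t, ‖X u s t‖ₑ ^ 2) ∂PX) < ∞)
    -- the sampling density is continuous and bounded
    (hg : Continuous g) (hgb : BddAbove (Set.range fun t => |g t|))
    -- `E ∫ e² < ∞`
    (he2 : (∫⁻ v, (∫⁻ s, ‖e v s‖ₑ ^ 2) ∂PE) < ∞) :
    -- pointwise consistency
    ((∀ s s' t t', Integrable (fun u => X u s t * X u s' t * X u s t' * X u s' t') PX) →
      ∀ s s', TendstoInMeasure μ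
        (fun n ω => pooledCov (observedCurve X e x T ε) m n ω s s') atTop
        (fun _ => totalCov PX PE X e g s s')) ∧
    -- consistency in Hilbert–Schmidt norm, and consistency of the scores,
    -- under `E ‖X(·,t)‖⁴ < ∞` for each `t` and `E ‖e‖⁴ < ∞`
    ((∀ t, (∫⁻ u, (∫⁻ s, ‖X u s t‖ₑ ^ 2) ^ 2 ∂PX) < ∞) →
      (∫⁻ v, (∫⁻ s, ‖e v s‖ₑ ^ 2) ^ 2 ∂PE) < ∞ →
      (∀ δ : ℝ≥0∞, 0 < δ → Tendsto (fun n => μ {ω | δ ≤ hsNorm fun s s' =>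
          pooledCov (observedCurve X e x T ε) m n ω s s' - totalCov PX PE X e g s s'})
        atTop (𝓝 0)) ∧
      ∀ (φ : ℕ → Lp ℝ 2 (volume : Measure unitInterval)) (lam : ℕ → ℝ)
        (φhat : ℕ → Ω → ℕ → Lp ℝ 2 (volume : Measure unitInterval)) (lamhat : ℕ → Ω → ℕ → ℝ),
        IsSpectralDecomposition (totalCov PX PE X e g) φ lam →
        (∀ n, ∀ᵐ ω ∂μ, IsSpectralDecomposition
          (pooledCov (observedCurve X e x T ε) m n ω) (φhat n ω) (lamhat n ω)) →
        ∀ k, (∀ l, l ≠ k → lam l ≠ lam k) →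
          -- the sign of the estimated eigenfunction is chosen to match that of `φ k`
          (∀ n, ∀ᵐ ω ∂μ, 0 ≤ inner ℝ (φhat n ω k) (φ k)) →
          ∀ i, TendstoInMeasure μ
            (fun n ω => ⨆ j : Fin (m i),
              |score (observedCurve X e x T ε i j ω) (φhat n ω k) -
                score (observedCurve X e x T ε i j ω) (φ k)|) atTop
            (fun _ => 0)) := by
  obtain ⟨hpointwise, hL2⟩ := corollary3_general μ PX PE X e g m x T ε hmodel hg.measurable
  exact ⟨fun _ => hpointwise, fun _ _ => hL2 he2⟩
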